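/- Let $\mathbb C^\alpha$ and $\mathbb C^\beta$ be the finite-dimensional Hilbert spaces of two parties $A$ and $B$. A state is a positive semidefinite operator of trace one; the set $\mathcal S_{A:B}$ of separable states is the convex hull of the product states $\sigma_A\otimes\tau_B$. Let $\mathsf M$ be one of the following four classes, each of which assigns to every pair of finite-dimensional spaces $A,B$ a set of operators $0\le M\le \mathbb I$ on $A\otimes B$: * $\mathsf{LOCC}^\to$ (resp. $\mathsf{LOCC}^\leftarrow$): the measurement $\{M,\mathbb I-M\}$ can be realised by local operations and one message of classical communication from Alice to Bob (resp. from Bob to Alice); * $\mathsf{LOCC}$: $\{M,\mathbb I-M\}$ can be realised by local operations and finitely many rounds of classical communication; * $\mathsf{SEP}$: both $M$ and $\mathbb I-M$ are finite sums $\sum_j P_j\otimes Q_j$ with $P_j,Q_j\ge 0$. For Hermitian $X$ on $A\otimes B$ put $\|X\|_{\mathsf M}=\sup_{M\in\mathsf M}\operatorname{tr}((2M-\mathbb I)X)$, and put $\|\rho_{AB}-\mathcal S_{A:B}\|_{\mathsf M}=\inf_{\sigma\in\mathcal S_{A:B}}\|\rho_{AB}-\sigma\|_{\mathsf M}$. Then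 for every state $\rho_{AB}$ there is exactly one real number $D_{\mathsf M}(\rho_{A:B})\ge 0$ with the following two properties (where $-\log_2 0=+\infty$). * Direct part: for every $\epsilon>0$ there are operators $M_n\in\mathsf M$ on $A^n:B^n$ ($n\in\mathbb N$) such that $\lim_{n\to\infty}\operatorname{tr}(M_n\rho_{AB}^{\otimes n})=1$ and $-\frac1n\log_2\operatorname{tr}(M_n\omega)\ge D_{\mathsf M}(\rho_{A:B})-\epsilon$ for every $n\ge1$ and every $\omega\in\mathcal S_{A^n:B^n}$. * Converse: if $\epsilon>0$ and operators $M_n\in\mathsf M$ on $A^n:B^n$ satisfy $-\frac1n\log_2\operatorname{tr}(M_n\omega)\ge D_{\mathsf M}(\rho_{A:B})+\epsilon$ for every $n\ge1$ and every $\omega\in\mathcal S_{A^n:B^n}$, then $\operatorname{tr}(M_n\rho_{AB}^{\otimes n})$ does not converge to $1$. Moreover, $$D_{\mathsf M}(\rho_{A:B})\ \ge\ \frac{1}{8\ln 2}\,\|\rho_{AB}-\mathcal S_{A:B}\|_{\mathsf M}^2 .$$ -/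

import Mathlib

open scoped Kronecker ComplexOrder

namespace BipartiteTesting

/-- Density matrices: positive semidefinite with trace one. -/
def IsState {ι : Type*} [Fintype ι] (ρ : Matrix ι ι ℂ) : Prop :=
  ρ.PosSemidef ∧ ρ.trace = 1

/-- The operator interval `0 ≤ M ≤ 1`. -/
def IsEffect {ι : Type*} [DecidableEq ι] (M : Matrix ι ι ℂ) : Prop :=
  M.PosSemidef ∧ (1 - M).PosSemidef

/-- The set of separable states of the bipartite system with Hilbert spaces `ℂ^α` and `ℂ^β`:
the convex hull of the product states. -/
def separableStates (α β : Type*) [Fintype α] [Fintype β] :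
    Set (Matrix (α × β) (α × β) ℂ) :=
  convexHull ℝ {ω | ∃ (σ : Matrix α α ℂ) (τ : Matrix β β ℂ),
    IsState σ ∧ IsState τ ∧ ω = σ ⊗ₖ τ}

/-- Separable operators: finite sums `∑ⱼ Pⱼ ⊗ Qⱼ` with `Pⱼ, Qⱼ ≥ 0` (no normalisation). -/
def separableOperators (α β : Type*) : Set (Matrix (α × β) (α × β) ℂ) :=
  {X | ∃ (m : ℕ) (P : Fin m → Matrix α α ℂ) (Q : Fin m → Matrix β β ℂ),
    (∀ j, (P j).PosSemidef) ∧ (∀ j, (Q j).PosSemidef) ∧ X = ∑ j, P j ⊗ₖ Q j}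

/-- The two parties. -/
inductive Party
  | alice
  | bob

/-- `IsRoundLOCC p k M`: the two-outcome measurement `{M, 1 - M}` can be realised by local operations
and `k` rounds of one-directional classical communication, alternating in direction, the first
message being sent by the party `p`.

* With no message left, the party whose turn it is performs a local two-outcome measurement
  `{E, 1 - E}`, which decides the outcome.
* Otherwise the party whose turn it is performs a local measurement with finitely many outcomes and
  Kraus operators `K j` (so `∑ⱼ Kⱼᴴ Kⱼ = 1`), and sends the outcome `j` to the other party; the
  protocol then goes on in a way that depends on `j`, with `M j` the effect which the remaining part
  of it measures. In the Heisenberg picture the whole protocol measures `∑ⱼ Kⱼᴴ Mⱼ Kⱼ`.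

An instrument with several Kraus operators per outcome is covered by repeating `M j`; ancillas,
local isometries and shared randomness give no further effects. -/
inductive IsRoundLOCC {α β : Type*} [Fintype α] [Fintype β] [DecidableEq α] [DecidableEq β] :
    Party → ℕ → Matrix (α × β) (α × β) ℂ → Prop
  | aliceFinal (E : Matrix α α ℂ) (hE : IsEffect E) :
      IsRoundLOCC Party.alice 0 (E ⊗ₖ (1 : Matrix β β ℂ))
  | bobFinal (E : Matrix β β ℂ) (hE : IsEffect E) :
      IsRoundLOCC Party.bob 0 ((1 : Matrix α α ℂ) ⊗ₖ E)
  | aliceSends (k m : ℕ) (K : Fin m → Matrix α α ℂ) (M : Fin m → Matrix (α × β) (α × β) ℂ)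
      (hK : ∑ j, (K j).conjTranspose * K j = 1) (hM : ∀ j, IsRoundLOCC Party.bob k (M j)) :
      IsRoundLOCC Party.alice (k + 1)
        (∑ j, (K j ⊗ₖ (1 : Matrix β β ℂ)).conjTranspose * M j * (K j ⊗ₖ (1 : Matrix β β ℂ)))
  | bobSends (k m : ℕ) (K : Fin m → Matrix β β ℂ) (M : Fin m → Matrix (α × β) (α × β) ℂ)
      (hK : ∑ j, (K j).conjTranspose * K j = 1) (hM : ∀ j, IsRoundLOCC Party.alice k (M j)) :
      IsRoundLOCC Party.bob (k + 1)
        (∑ j, ((1 : Matrix α α ℂ) ⊗ₖ K j).conjTranspose * M j * ((1 : Matrix α α ℂ) ⊗ₖ K j))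

/-- The four classes of measurements: one-way LOCC from Alice to Bob, one-way LOCC from Bob to
Alice, LOCC, and separable measurements. -/
inductive MeasurementClass
  | oneWayAliceToBob
  | oneWayBobToAlice
  | locc
  | sep

/-- The operators `M` on `ℂ^α ⊗ ℂ^β` for which the measurement `{M, 1 - M}` is in the class.
An LOCC protocol has an arbitrary finite number of rounds; a measurement is separable if both of its
elements are separable operators. -/
def MeasurementClass.effects (C : MeasurementClass) (α β : Type*) [Fintype α] [Fintype β]
    [DecidableEq α] [DecidableEq β] : Set (Matrix (α × β) (α × β) ℂ) :=
  match C with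
  | .oneWayAliceToBob => {M | IsRoundLOCC Party.alice 1 M}
  | .oneWayBobToAlice => {M | IsRoundLOCC Party.bob 1 M}
  | .locc => {M | ∃ k, IsRoundLOCC Party.alice k M}
  | .sep => {M | M ∈ separableOperators α β ∧ 1 - M ∈ separableOperators α β}

/-- The norm `‖X‖_C = sup_{M ∈ C} tr((2M - 1) X)` of a Hermitian operator `X`. -/
noncomputable def restrictedNorm (C : MeasurementClass) {α β : Type*} [Fintype α] [Fintype β]
    [DecidableEq α] [DecidableEq β] (X : Matrix (α × β) (α × β) ℂ) : ℝ :=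
  sSup ((fun M : Matrix (α × β) (α × β) ℂ => (((2 : ℂ) • M - 1) * X).trace.re) '' C.effects α β)

/-- The distance `‖ρ - S‖_C` of `ρ` from the set `S` of separable states. -/
noncomputable def distToSeparable (C : MeasurementClass) {α β : Type*} [Fintype α] [Fintype β]
    [DecidableEq α] [DecidableEq β] (ρ : Matrix (α × β) (α × β) ℂ) : ℝ :=
  sInf ((fun σ : Matrix (α × β) (α × β) ℂ => restrictedNorm C (ρ - σ)) '' separableStates α β)

/-- The state `ρ^{⊗ n}`, viewed as a bipartite state of `Aⁿ` and `Bⁿ`, whose Hilbert spaces have the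
product bases indexed by `Fin n → α` and `Fin n → β`. -/
def tensorPower {α β : Type*} (ρ : Matrix (α × β) (α × β) ℂ) (n : ℕ) :
    Matrix ((Fin n → α) × (Fin n → β)) ((Fin n → α) × (Fin n → β)) ℂ :=
  Matrix.of fun x y => ∏ i, ρ (x.1 i, x.2 i) (y.1 i, y.2 i)

/-- A test: for every number `n` of copies, an element of the class `C` for the cut `Aⁿ : Bⁿ`. -/
def IsTest (C : MeasurementClass) {α β : Type*} [Fintype α] [Fintype β]
    [DecidableEq α] [DecidableEq β]
    (M : (n : ℕ) → Matrix ((Fin n → α) × (Fin n → β)) ((Fin n → α) × (Fin n → β)) ℂ) : Prop :=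
  ∀ n, M n ∈ C.effects (Fin n → α) (Fin n → β)

/-- `-(1/n) log₂ tr(Mₙ ω) ≥ r` for every `n ≥ 1` and every state `ω` separable in the cut `Aⁿ : Bⁿ`.
It is written as `tr(Mₙ ω) ≤ 2^(-n r)`, so that `-log₂ 0` counts as `+∞`. -/
def SeparableErrorRateAtLeast {α β : Type*} [Fintype α] [Fintype β]
    (M : (n : ℕ) → Matrix ((Fin n → α) × (Fin n → β)) ((Fin n → α) × (Fin n → β)) ℂ)
    (r : ℝ) : Prop :=
  ∀ n : ℕ, 1 ≤ n → ∀ ω ∈ separableStates (Fin n → α) (Fin n → β),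
    (M n * ω).trace.re ≤ (2 : ℝ) ^ (-((n : ℝ) * r))

/-- `tr(Mₙ ρ^{⊗ n}) → 1`. -/
def AcceptsAsymptotically {α β : Type*} [Fintype α] [Fintype β]
    (M : (n : ℕ) → Matrix ((Fin n → α) × (Fin n → β)) ((Fin n → α) × (Fin n → β)) ℂ)
    (ρ : Matrix (α × β) (α × β) ℂ) : Prop :=
  Filter.Tendsto (fun n => (M n * tensorPower ρ n).trace.re) Filter.atTop (nhds 1)

/-- `D` is the optimal rate `D_C(ρ)` at which `ρ^{⊗ n}` is told apart from arbitrary separable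
states by measurements of the class `C`: the direct part and the converse. -/
structure IsOptimalRate (C : MeasurementClass) {α β : Type*} [Fintype α] [Fintype β]
    [DecidableEq α] [DecidableEq β] (ρ : Matrix (α × β) (α × β) ℂ) (D : ℝ) : Prop where
  nonneg : 0 ≤ D
  direct : ∀ ε : ℝ, 0 < ε → ∃ M, IsTest C M ∧ AcceptsAsymptotically M ρ ∧
    SeparableErrorRateAtLeast M (D - ε)
  converse : ∀ ε : ℝ, 0 < ε → ∀ M, IsTest C M → SeparableErrorRateAtLeast M (D + ε) →
    ¬ AcceptsAsymptotically M ρ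

end BipartiteTesting

/-! Call a rate achievable if some sequence of tests in the class accepts `ρ^{⊗ n}` asymptotically
and has separable error rate at least that number. The optimal rate is the supremum of the
achievable rates: the direct part and the converse are the two halves of being a supremum, and they
also force uniqueness. The supremum exists because the rate `0` is achieved by always accepting, and
because the achievable rates are bounded: a test with small error on separable states has small
trace, hence a small value on every state (`IsAchievable.le`).

For the quantitative bound, minimax (`exists_effect_of_lt_distToSeparable`) turns the distance into
one effect `M` in the class with `tr(Mρ) - tr(Mσ) > y` for all separable `σ` at once, for any `y`
below half the distance. Measure `M` on each copy and accept if it occurs often enough. On `ρ^{⊗ n}`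
the outcomes are independent. On an arbitrary separable state of `Aⁿ : Bⁿ` they need not be, but `M`
and `1 - M` are separable operators, so the remaining copies, conditioned on earlier outcomes, are
again separable (`contract_mem_separableOperators`). Each conditional probability of `M` is then at
most `tr(Mρ) - y`, and the Chernoff bound holds as for independent trials
(`trace_thresholdTest_mul_le`). The exponent `x²/2` with `x` tending to half the distance gives the
constant `1/(8 ln 2)`.

Only four facts about the class enter: it contains `1`, it is convex, its measurements are
separable, and it is closed under these threshold tests. -/

namespace BipartiteTesting

open Matrix

/-! ### Positive semidefinite matrices. -/

section PosSemidef

variable {ι : Type*} [Fintype ι]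

open scoped MatrixOrder in
lemma exists_eq_conjTranspose_mul_self [DecidableEq ι] {M : Matrix ι ι ℂ} (hM : M.PosSemidef) :
    ∃ A : Matrix ι ι ℂ, M = Aᴴ * A :=
  CStarAlgebra.nonneg_iff_eq_star_mul_self.mp hM.nonneg

lemma trace_mul_nonneg {M N : Matrix ι ι ℂ} (hM : M.PosSemidef) (hN : N.PosSemidef) :
    0 ≤ (M * N).trace := by
  classical
  obtain ⟨A, rfl⟩ := exists_eq_conjTranspose_mul_self hM
  obtain ⟨B, rfl⟩ := exists_eq_conjTranspose_mul_self hN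
  have h : (Aᴴ * A * (Bᴴ * B)).trace = ((A * Bᴴ)ᴴ * (A * Bᴴ)).trace := by
    rw [conjTranspose_mul, conjTranspose_conjTranspose, Matrix.mul_assoc, Matrix.trace_mul_comm]
    simp only [Matrix.mul_assoc]
    rw [Matrix.trace_mul_comm]
    simp only [Matrix.mul_assoc]
    rw [Matrix.trace_mul_comm]
    simp only [Matrix.mul_assoc]
  rw [h]
  exact (posSemidef_conjTranspose_mul_self _).trace_nonneg

/-- Writing `M = Aᴴ A`, an entry is an inner product of two columns of `A`, and the trace is the sum
of all squared column norms. -/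
lemma norm_apply_le_trace {M : Matrix ι ι ℂ} (hM : M.PosSemidef) (i j : ι) :
    ‖M i j‖ ≤ M.trace.re := by
  classical
  obtain ⟨A, rfl⟩ := exists_eq_conjTranspose_mul_self hM
  have htr : (Aᴴ * A).trace.re = ∑ k, ∑ l, ‖A k l‖ ^ 2 := by
    rw [Finset.sum_comm]
    simp only [Matrix.trace, Matrix.diag, Matrix.mul_apply, Matrix.conjTranspose_apply,
      Complex.re_sum]
    refine Finset.sum_congr rfl fun l _ => Finset.sum_congr rfl fun k _ => ?_
    rw [← Complex.normSq_eq_norm_sq, Complex.normSq_apply]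
    simp
  rw [htr, Matrix.mul_apply]
  refine (norm_sum_le _ _).trans (Finset.sum_le_sum fun k _ => ?_)
  have hi := Finset.single_le_sum (f := fun l => ‖A k l‖ ^ 2) (fun l _ => sq_nonneg _)
    (Finset.mem_univ i)
  have hj := Finset.single_le_sum (f := fun l => ‖A k l‖ ^ 2) (fun l _ => sq_nonneg _)
    (Finset.mem_univ j)
  simp only [Matrix.conjTranspose_apply, norm_mul, norm_star]
  beta_reduce at hi hj
  nlinarith [sq_nonneg (‖A k i‖ - ‖A k j‖)]

lemma norm_trace_mul_le {M X : Matrix ι ι ℂ} {c : ℝ} (hM : ∀ i j, ‖M i j‖ ≤ c) :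
    ‖(M * X).trace‖ ≤ c * ∑ i, ∑ j, ‖X i j‖ := by
  simp only [Matrix.trace, Matrix.diag, Matrix.mul_apply]
  rw [Finset.sum_comm, Finset.mul_sum]
  refine (norm_sum_le _ _).trans (Finset.sum_le_sum fun i _ => ?_)
  rw [Finset.mul_sum]
  refine (norm_sum_le _ _).trans (Finset.sum_le_sum fun j _ => ?_)
  rw [norm_mul]
  exact mul_le_mul_of_nonneg_right (hM _ _) (norm_nonneg _)

end PosSemidef

lemma IsEffect.zero {ι : Type*} [DecidableEq ι] : IsEffect (0 : Matrix ι ι ℂ) :=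
  ⟨PosSemidef.zero, by simpa using PosSemidef.one⟩

lemma IsEffect.one {ι : Type*} [DecidableEq ι] : IsEffect (1 : Matrix ι ι ℂ) :=
  ⟨PosSemidef.one, by simpa using PosSemidef.zero⟩

lemma sub_kronecker {ι κ : Type*} (A B : Matrix ι ι ℂ) (C : Matrix κ κ ℂ) :
    (A - B) ⊗ₖ C = A ⊗ₖ C - B ⊗ₖ C := by
  ext; simp [sub_mul]

lemma kronecker_sub {ι κ : Type*} (A : Matrix ι ι ℂ) (B C : Matrix κ κ ℂ) :
    A ⊗ₖ (B - C) = A ⊗ₖ B - A ⊗ₖ C := by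
  ext; simp [mul_sub]

lemma sum_kronecker {ι κ ν : Type*} (s : Finset ν) (A : ν → Matrix ι ι ℂ) (C : Matrix κ κ ℂ) :
    (∑ j ∈ s, A j) ⊗ₖ C = ∑ j ∈ s, A j ⊗ₖ C := by
  ext; simp [Matrix.sum_apply, Finset.sum_mul]

lemma kronecker_sum {ι κ ν : Type*} (s : Finset ν) (A : Matrix ι ι ℂ) (C : ν → Matrix κ κ ℂ) :
    A ⊗ₖ (∑ j ∈ s, C j) = ∑ j ∈ s, A ⊗ₖ C j := by
  ext; simp [Matrix.sum_apply, Finset.mul_sum]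

/-! ### Tensor products up to reindexing, and partial traces. -/

section Joint

variable {A B α α' β β' : Type*}

/-- The operator `M ⊗ N` on a space which is identified with a tensor product by `e`. -/
def joint (e : A ≃ α × α') (M : Matrix α α ℂ) (N : Matrix α' α' ℂ) : Matrix A A ℂ :=
  (M ⊗ₖ N).submatrix e e

/-- The identification of `A ⊗ B` with `(α ⊗ β) ⊗ (α' ⊗ β')` where `A = α ⊗ α'` and
`B = β ⊗ β'`. -/
def pairEquiv (e : A ≃ α × α') (f : B ≃ β × β') : A × B ≃ (α × β) × (α' × β') :=
  (e.prodCongr f).trans (Equiv.prodProdProdComm _ _ _ _)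

lemma joint_apply (e : A ≃ α × α') (M : Matrix α α ℂ) (N : Matrix α' α' ℂ) (x y : A) :
    joint e M N x y = M (e x).1 (e y).1 * N (e x).2 (e y).2 := rfl

lemma joint_add_left (e : A ≃ α × α') (M M' : Matrix α α ℂ) (N : Matrix α' α' ℂ) :
    joint e (M + M') N = joint e M N + joint e M' N := by
  ext; simp [joint_apply, add_mul]

lemma joint_sub_left (e : A ≃ α × α') (M M' : Matrix α α ℂ) (N : Matrix α' α' ℂ) :
    joint e (M - M') N = joint e M N - joint e M' N := by
  ext; simp [joint_apply, sub_mul]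

lemma joint_sub_right (e : A ≃ α × α') (M : Matrix α α ℂ) (N N' : Matrix α' α' ℂ) :
    joint e M (N - N') = joint e M N - joint e M N' := by
  ext; simp [joint_apply, mul_sub]

lemma joint_add_right (e : A ≃ α × α') (M : Matrix α α ℂ) (N N' : Matrix α' α' ℂ) :
    joint e M (N + N') = joint e M N + joint e M N' := by
  ext; simp [joint_apply, mul_add]

lemma joint_zero_left (e : A ≃ α × α') (N : Matrix α' α' ℂ) :
    joint e (0 : Matrix α α ℂ) N = 0 := by
  ext; simp [joint_apply]

lemma joint_zero_right (e : A ≃ α × α') (M : Matrix α α ℂ) :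
    joint e M (0 : Matrix α' α' ℂ) = 0 := by
  ext; simp [joint_apply]

lemma joint_sum_left {ι : Type*} (s : Finset ι) (e : A ≃ α × α') (M : ι → Matrix α α ℂ)
    (N : Matrix α' α' ℂ) : joint e (∑ i ∈ s, M i) N = ∑ i ∈ s, joint e (M i) N := by
  ext; simp [joint_apply, Matrix.sum_apply, Finset.sum_mul]

lemma joint_sum_right {ι : Type*} (s : Finset ι) (e : A ≃ α × α') (M : Matrix α α ℂ)
    (N : ι → Matrix α' α' ℂ) : joint e M (∑ i ∈ s, N i) = ∑ i ∈ s, joint e M (N i) := by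
  ext; simp [joint_apply, Matrix.sum_apply, Finset.mul_sum]

lemma joint_conjTranspose (e : A ≃ α × α') (M : Matrix α α ℂ) (N : Matrix α' α' ℂ) :
    (joint e M N)ᴴ = joint e Mᴴ Nᴴ := by
  ext; simp [joint_apply]

lemma joint_one_one [DecidableEq A] [DecidableEq α] [DecidableEq α'] (e : A ≃ α × α') :
    joint e (1 : Matrix α α ℂ) (1 : Matrix α' α' ℂ) = 1 := by
  simp [joint]

lemma joint_mul_joint [Fintype A] [Fintype α] [Fintype α'] (e : A ≃ α × α')
    (M M' : Matrix α α ℂ) (N N' : Matrix α' α' ℂ) :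
    joint e M N * joint e M' N' = joint e (M * M') (N * N') := by
  rw [joint, joint, submatrix_mul_equiv, ← mul_kronecker_mul, joint]

lemma trace_joint [Fintype A] [Fintype α] [Fintype α'] (e : A ≃ α × α')
    (M : Matrix α α ℂ) (N : Matrix α' α' ℂ) :
    (joint e M N).trace = M.trace * N.trace := by
  rw [← trace_kronecker]
  exact e.sum_comp fun x => (M ⊗ₖ N) x x

lemma joint_posSemidef [Finite α] [Finite α'] (e : A ≃ α × α') {M : Matrix α α ℂ}
    {N : Matrix α' α' ℂ} (hM : M.PosSemidef) (hN : N.PosSemidef) : (joint e M N).PosSemidef :=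
  (hM.kronecker hN).submatrix e

lemma joint_pairEquiv_kronecker (e : A ≃ α × α') (f : B ≃ β × β') (P : Matrix α α ℂ)
    (Q : Matrix β β ℂ) (P' : Matrix α' α' ℂ) (Q' : Matrix β' β' ℂ) :
    joint (pairEquiv e f) (P ⊗ₖ Q) (P' ⊗ₖ Q') = joint e P P' ⊗ₖ joint f Q Q' := by
  ext x y
  simp only [joint_apply, pairEquiv, Matrix.kroneckerMap_apply, Equiv.trans_apply,
    Equiv.prodCongr_apply, Equiv.prodProdProdComm_apply, Prod.map]
  ring

/-- The partial trace of `(M ⊗ 1) X` over the first tensor factor. -/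
def contract [Fintype α] (e : A ≃ α × α') (M : Matrix α α ℂ) (X : Matrix A A ℂ) :
    Matrix α' α' ℂ :=
  Matrix.of fun x y => ∑ a, ∑ b, M a b * X (e.symm (b, x)) (e.symm (a, y))

lemma trace_joint_mul [Fintype A] [Fintype α] [Fintype α'] (e : A ≃ α × α')
    (M : Matrix α α ℂ) (N : Matrix α' α' ℂ) (X : Matrix A A ℂ) :
    (joint e M N * X).trace = (N * contract e M X).trace := by
  have h : (joint e M N * X).trace
      = ∑ p : α × α', ∑ q : α × α', M p.1 q.1 * N p.2 q.2 * X (e.symm q) (e.symm p) := by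
    simp only [Matrix.trace, Matrix.diag, Matrix.mul_apply]
    rw [← e.symm.sum_comp]
    refine Finset.sum_congr rfl fun p _ => ?_
    rw [← e.symm.sum_comp]
    simp [joint_apply]
  rw [h]
  simp only [Matrix.trace, Matrix.diag, Matrix.mul_apply, contract, Matrix.of_apply,
    Fintype.sum_prod_type, Finset.mul_sum]
  rw [Finset.sum_comm]
  refine Finset.sum_congr rfl fun x _ => ?_
  conv_rhs => rw [Finset.sum_comm]
  refine Finset.sum_congr rfl fun a _ => ?_
  rw [Finset.sum_comm]
  refine Finset.sum_congr rfl fun b _ => Finset.sum_congr rfl fun y _ => ?_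
  ring

lemma contract_posSemidef [Fintype A] [Fintype α] [Fintype α'] (e : A ≃ α × α')
    {M : Matrix α α ℂ} {X : Matrix A A ℂ} (hM : M.PosSemidef) (hX : X.PosSemidef) :
    (contract e M X).PosSemidef := by
  classical
  obtain ⟨K, rfl⟩ := exists_eq_conjTranspose_mul_self hM
  -- With `M = Kᴴ K`, row `k` of `K` gives a map `W k`, and the partial trace takes the Kraus form
  -- `∑ₖ (W k)ᴴ X (W k)`, which is visibly positive.
  let W : α → Matrix A α' ℂ := fun k => Matrix.of fun z y =>
    if (e z).2 = y then star (K k (e z).1) else 0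
  have h : contract e (Kᴴ * K) X = ∑ k, (W k)ᴴ * X * W k := by
    ext x y
    have h1 : ∀ k, ((W k)ᴴ * X * W k) x y
        = ∑ a, ∑ b, star (K k a) * K k b * X (e.symm (b, x)) (e.symm (a, y)) := by
      intro k
      simp only [Matrix.mul_apply, Matrix.conjTranspose_apply, W, Matrix.of_apply]
      rw [← e.symm.sum_comp]
      simp only [Equiv.apply_symm_apply, Fintype.sum_prod_type, mul_ite, mul_zero,
        Finset.sum_ite_eq', Finset.mem_univ, if_true]
      refine Finset.sum_congr rfl fun a _ => ?_
      rw [← e.symm.sum_comp]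
      simp only [Equiv.apply_symm_apply, Fintype.sum_prod_type, apply_ite star, star_star,
        star_zero, ite_mul, zero_mul, Finset.sum_ite_eq', Finset.mem_univ, if_true,
        Finset.sum_mul]
      refine Finset.sum_congr rfl fun b _ => ?_
      ring
    rw [Matrix.sum_apply]
    simp only [h1, contract, Matrix.of_apply, Matrix.mul_apply, Matrix.conjTranspose_apply,
      Finset.sum_mul]
    conv_rhs => rw [Finset.sum_comm]
    refine Finset.sum_congr rfl fun a _ => ?_
    rw [Finset.sum_comm]
  rw [h]
  exact posSemidef_sum _ fun k _ => hX.conjTranspose_mul_mul_same (W k)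

lemma contract_kronecker [Fintype α] [Fintype β] (e : A ≃ α × α') (f : B ≃ β × β')
    (P : Matrix α α ℂ) (Q : Matrix β β ℂ) (R : Matrix A A ℂ) (S : Matrix B B ℂ) :
    contract (pairEquiv e f) (P ⊗ₖ Q) (R ⊗ₖ S) = contract e P R ⊗ₖ contract f Q S := by
  ext x y
  simp only [contract, pairEquiv, Matrix.of_apply, Matrix.kroneckerMap_apply,
    Fintype.sum_prod_type, Finset.sum_mul_sum, Equiv.symm_trans_apply,
    Equiv.prodProdProdComm_symm, Equiv.prodProdProdComm_apply, Equiv.prodCongr_symm,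
    Equiv.prodCongr_apply, Prod.map]
  refine Finset.sum_congr rfl fun a _ => ?_
  refine Finset.sum_congr rfl fun b _ => Finset.sum_congr rfl fun c _ =>
    Finset.sum_congr rfl fun d _ => ?_
  ring

lemma contract_add_left [Fintype α] (e : A ≃ α × α') (M M' : Matrix α α ℂ) (X : Matrix A A ℂ) :
    contract e (M + M') X = contract e M X + contract e M' X := by
  ext; simp [contract, add_mul, Finset.sum_add_distrib]

lemma contract_add_right [Fintype α] (e : A ≃ α × α') (M : Matrix α α ℂ) (X X' : Matrix A A ℂ) :
    contract e M (X + X') = contract e M X + contract e M X' := by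
  ext; simp [contract, mul_add, Finset.sum_add_distrib]

lemma contract_zero_left [Fintype α] (e : A ≃ α × α') (X : Matrix A A ℂ) :
    contract e 0 X = 0 := by
  ext; simp [contract]

lemma contract_zero_right [Fintype α] (e : A ≃ α × α') (M : Matrix α α ℂ) :
    contract e M 0 = 0 := by
  ext; simp [contract]

/-- The two ways to take the trace of `(M ⊗ 1) X`. -/
lemma trace_contract [Fintype A] [Fintype α] [Fintype α'] [DecidableEq α'] (e : A ≃ α × α')
    (M : Matrix α α ℂ) (X : Matrix A A ℂ) :
    (contract e M X).trace = (M * contract (e.trans (Equiv.prodComm _ _)) 1 X).trace := by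
  have h := trace_joint_mul e M (1 : Matrix α' α' ℂ) X
  rw [Matrix.one_mul] at h
  rw [← h, ← trace_joint_mul]
  congr 2
  ext x y
  simp only [joint_apply, Equiv.trans_apply, Equiv.prodComm_apply, Prod.snd_swap]
  exact mul_comm _ _

end Joint

/-! ### The cone of separable operators. -/

section Separable

variable {α β : Type*}

lemma sum_mem_separableOperators {ι : Type*} [Fintype ι] {P : ι → Matrix α α ℂ}
    {Q : ι → Matrix β β ℂ} (hP : ∀ j, (P j).PosSemidef) (hQ : ∀ j, (Q j).PosSemidef) :
    ∑ j, P j ⊗ₖ Q j ∈ separableOperators α β :=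
  ⟨Fintype.card ι, fun j => P ((Fintype.equivFin ι).symm j),
    fun j => Q ((Fintype.equivFin ι).symm j), fun _ => hP _, fun _ => hQ _,
    ((Fintype.equivFin ι).symm.sum_comp fun j => P j ⊗ₖ Q j).symm⟩

lemma kronecker_mem_separableOperators {P : Matrix α α ℂ} {Q : Matrix β β ℂ}
    (hP : P.PosSemidef) (hQ : Q.PosSemidef) : P ⊗ₖ Q ∈ separableOperators α β :=
  ⟨1, fun _ => P, fun _ => Q, fun _ => hP, fun _ => hQ, by simp⟩

lemma zero_mem_separableOperators : 0 ∈ separableOperators α β :=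
  ⟨0, fun _ => 0, fun _ => 0, fun j => j.elim0, fun j => j.elim0, by simp⟩

lemma add_mem_separableOperators {X Y : Matrix (α × β) (α × β) ℂ}
    (hX : X ∈ separableOperators α β) (hY : Y ∈ separableOperators α β) :
    X + Y ∈ separableOperators α β := by
  obtain ⟨m, P, Q, hP, hQ, rfl⟩ := hX
  obtain ⟨m', P', Q', hP', hQ', rfl⟩ := hY
  have := sum_mem_separableOperators (P := Sum.elim P P') (Q := Sum.elim Q Q')
    (by rintro (j | j); exacts [hP j, hP' j]) (by rintro (j | j); exacts [hQ j, hQ' j])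
  simpa [Fintype.sum_sum_type] using this

lemma finsetSum_mem_separableOperators {ι : Type*} (s : Finset ι)
    {X : ι → Matrix (α × β) (α × β) ℂ} (hX : ∀ i ∈ s, X i ∈ separableOperators α β) :
    ∑ i ∈ s, X i ∈ separableOperators α β :=
  Finset.sum_induction _ (· ∈ separableOperators α β) (fun _ _ => add_mem_separableOperators)
    zero_mem_separableOperators hX

@[elab_as_elim]
lemma separableOperators_induction
    {p : (X : Matrix (α × β) (α × β) ℂ) → X ∈ separableOperators α β → Prop}
    (zero : p 0 zero_mem_separableOperators)
    (add : ∀ X Y hX hY, p X hX → p Y hY → p (X + Y) (add_mem_separableOperators hX hY))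
    (prod : ∀ (P : Matrix α α ℂ) (Q : Matrix β β ℂ) (hP : P.PosSemidef) (hQ : Q.PosSemidef),
      p (P ⊗ₖ Q) (kronecker_mem_separableOperators hP hQ))
    {X : Matrix (α × β) (α × β) ℂ} (hX : X ∈ separableOperators α β) : p X hX := by
  suffices h : ∃ h, p X h from h.2
  obtain ⟨m, P, Q, hP, hQ, rfl⟩ := hX
  exact Finset.sum_induction _ (fun X => ∃ h, p X h)
    (fun X Y ⟨hX, hpX⟩ ⟨hY, hpY⟩ => ⟨_, add X Y hX hY hpX hpY⟩) ⟨_, zero⟩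
    fun j _ => ⟨_, prod _ _ (hP j) (hQ j)⟩

lemma smul_mem_separableOperators {c : ℝ} (hc : 0 ≤ c) {X : Matrix (α × β) (α × β) ℂ}
    (hX : X ∈ separableOperators α β) : c • X ∈ separableOperators α β := by
  induction hX using separableOperators_induction with
  | zero => simpa using zero_mem_separableOperators
  | add X Y _ _ hX hY => simpa using add_mem_separableOperators hX hY
  | prod P Q hP hQ =>
    rw [← smul_kronecker]
    exact kronecker_mem_separableOperators (hP.smul hc) hQ

lemma one_mem_separableOperators [DecidableEq α] [DecidableEq β] :
    1 ∈ separableOperators α β := by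
  rw [← one_kronecker_one]
  exact kronecker_mem_separableOperators PosSemidef.one PosSemidef.one

lemma posSemidef_of_mem_separableOperators [Finite α] [Finite β] {X : Matrix (α × β) (α × β) ℂ}
    (hX : X ∈ separableOperators α β) : X.PosSemidef := by
  induction hX using separableOperators_induction with
  | zero => exact PosSemidef.zero
  | add X Y _ _ hX hY => exact hX.add hY
  | prod P Q hP hQ => exact hP.kronecker hQ

/-- Local operators map separable operators to separable operators. -/
lemma conj_mem_separableOperators [Fintype α] [Fintype β] {X : Matrix (α × β) (α × β) ℂ}
    (hX : X ∈ separableOperators α β) (K : Matrix α α ℂ) (L : Matrix β β ℂ) :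
    (K ⊗ₖ L)ᴴ * X * (K ⊗ₖ L) ∈ separableOperators α β := by
  induction hX using separableOperators_induction with
  | zero => simpa using zero_mem_separableOperators
  | add X Y _ _ hX hY => simpa [Matrix.mul_add, Matrix.add_mul] using add_mem_separableOperators hX hY
  | prod P Q hP hQ =>
    rw [conjTranspose_kronecker, ← mul_kronecker_mul, ← mul_kronecker_mul]
    exact kronecker_mem_separableOperators (hP.conjTranspose_mul_mul_same K)
      (hQ.conjTranspose_mul_mul_same L)

variable {A B α' β' : Type*}

lemma joint_mem_separableOperators [Finite α] [Finite α'] [Finite β] [Finite β']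
    (e : A ≃ α × α') (f : B ≃ β × β')
    {M : Matrix (α × β) (α × β) ℂ} {N : Matrix (α' × β') (α' × β') ℂ}
    (hM : M ∈ separableOperators α β) (hN : N ∈ separableOperators α' β') :
    joint (pairEquiv e f) M N ∈ separableOperators A B := by
  induction hM using separableOperators_induction with
  | zero => simpa [joint_zero_left] using zero_mem_separableOperators
  | add X Y _ _ hX hY => simpa [joint_add_left] using add_mem_separableOperators hX hY
  | prod P Q hP hQ =>
    induction hN using separableOperators_induction with
    | zero => simpa [joint_zero_right] using zero_mem_separableOperators
    | add X Y _ _ hX hY => simpa [joint_add_right] using add_mem_separableOperators hX hY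
    | prod P' Q' hP' hQ' =>
      rw [joint_pairEquiv_kronecker]
      exact kronecker_mem_separableOperators (joint_posSemidef _ hP hP') (joint_posSemidef _ hQ hQ')

/-- Product operators contract to product operators, and each local factor stays positive.
Consequently a separable measurement on some copies leaves the others in an unnormalised separable
state, even if the copies were correlated. -/
lemma contract_mem_separableOperators [Fintype α] [Fintype α'] [Fintype β] [Fintype β'] [Fintype A]
    [Fintype B] (e : A ≃ α × α') (f : B ≃ β × β')
    {M : Matrix (α × β) (α × β) ℂ} {X : Matrix (A × B) (A × B) ℂ}
    (hM : M ∈ separableOperators α β) (hX : X ∈ separableOperators A B) :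
    contract (pairEquiv e f) M X ∈ separableOperators α' β' := by
  induction hM using separableOperators_induction with
  | zero => simpa [contract_zero_left] using zero_mem_separableOperators
  | add X Y _ _ hX hY => simpa [contract_add_left] using add_mem_separableOperators hX hY
  | prod P Q hP hQ =>
    induction hX using separableOperators_induction with
    | zero => simpa [contract_zero_right] using zero_mem_separableOperators
    | add X Y _ _ hX hY => simpa [contract_add_right] using add_mem_separableOperators hX hY
    | prod R S hR hS =>
      rw [contract_kronecker]
      exact kronecker_mem_separableOperators (contract_posSemidef _ hP hR)
        (contract_posSemidef _ hQ hS)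

end Separable

/-! ### Separable states as the normalised part of the cone. -/

section States

variable {α β : Type*} [Fintype α] [Fintype β]

lemma separableStates_subset :
    separableStates α β ⊆ {X | X ∈ separableOperators α β ∧ X.trace = 1} := by
  refine convexHull_min ?_ ?_
  · rintro _ ⟨σ, τ, hσ, hτ, rfl⟩
    exact ⟨kronecker_mem_separableOperators hσ.1 hτ.1, by rw [trace_kronecker, hσ.2, hτ.2, one_mul]⟩
  · rintro X ⟨hX, hX'⟩ Y ⟨hY, hY'⟩ a b ha hb hab
    refine ⟨add_mem_separableOperators (smul_mem_separableOperators ha hX)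
      (smul_mem_separableOperators hb hY), ?_⟩
    rw [trace_add, trace_smul, trace_smul, hX', hY', ← add_smul, hab, one_smul]

lemma IsState.kronecker_mem_separableStates {σ : Matrix α α ℂ} {τ : Matrix β β ℂ}
    (hσ : IsState σ) (hτ : IsState τ) : σ ⊗ₖ τ ∈ separableStates α β :=
  subset_convexHull _ _ ⟨σ, τ, hσ, hτ, rfl⟩

lemma exists_eq_smul_isState {ι : Type*} [Fintype ι] [Nonempty ι] {P : Matrix ι ι ℂ}
    (hP : P.PosSemidef) :
    ∃ σ : Matrix ι ι ℂ, IsState σ ∧ P = P.trace.re • σ := by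
  classical
  have hre : P.trace = (P.trace.re : ℂ) := by
    have := hP.trace_nonneg
    rw [Complex.le_def] at this
    exact Complex.ext rfl (by simpa using this.2.symm)
  -- A positive operator of trace zero vanishes; any state serves then, here the maximally mixed
  -- one.
  by_cases h : P.trace = 0
  · refine ⟨(Fintype.card ι : ℝ)⁻¹ • 1, ⟨PosSemidef.one.smul (by positivity), ?_⟩, ?_⟩
    · rw [trace_smul, trace_one, Complex.real_smul]
      have : (Fintype.card ι : ℂ) ≠ 0 := by simp
      push_cast
      field_simp
    · rw [h, hP.trace_eq_zero_iff.1 h]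
      simp
  · have h' : P.trace.re ≠ 0 := by
      intro h0
      rw [hre, h0] at h
      simp at h
    refine ⟨P.trace.re⁻¹ • P, ⟨hP.smul ?_, ?_⟩, ?_⟩
    · exact inv_nonneg.2 (Complex.le_def.1 hP.trace_nonneg).1
    · rw [trace_smul, Complex.real_smul]
      nth_rewrite 2 [hre]
      rw [← Complex.ofReal_mul, inv_mul_cancel₀ h', Complex.ofReal_one]
    · rw [smul_smul, mul_inv_cancel₀ h', one_smul]

/-- A bound on the separable states extends to the cone of separable operators. -/
lemma trace_mul_le_of_forall_separableStates [Nonempty α] [Nonempty β]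
    {M : Matrix (α × β) (α × β) ℂ} {q : ℝ}
    (hM : ∀ σ ∈ separableStates α β, (M * σ).trace.re ≤ q)
    {X : Matrix (α × β) (α × β) ℂ} (hX : X ∈ separableOperators α β) :
    (M * X).trace.re ≤ q * X.trace.re := by
  induction hX using separableOperators_induction with
  | zero => simp
  | add X Y _ _ hX hY =>
    rw [Matrix.mul_add, trace_add, trace_add, Complex.add_re, Complex.add_re, mul_add]
    exact add_le_add hX hY
  | prod P Q hP hQ =>
    obtain ⟨σ, hσ, hPσ⟩ := exists_eq_smul_isState hP
    obtain ⟨τ, hτ, hQτ⟩ := exists_eq_smul_isState hQ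
    have hp : 0 ≤ P.trace.re := (Complex.le_def.1 hP.trace_nonneg).1
    have hq : 0 ≤ Q.trace.re := (Complex.le_def.1 hQ.trace_nonneg).1
    have h := hM _ (hσ.kronecker_mem_separableStates hτ)
    have hPQ : P ⊗ₖ Q = (P.trace.re * Q.trace.re) • (σ ⊗ₖ τ) := by
      conv_lhs => rw [hPσ, hQτ, smul_kronecker, kronecker_smul, smul_smul]
    rw [hPQ, Matrix.mul_smul, trace_smul, trace_smul, trace_kronecker, hσ.2, hτ.2, Complex.smul_re,
      Complex.smul_re, mul_one, Complex.one_re, smul_eq_mul, smul_eq_mul, mul_one, mul_comm q]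
    exact mul_le_mul_of_nonneg_left h (mul_nonneg hp hq)

lemma separableStates_nonempty [Nonempty α] [Nonempty β] : (separableStates α β).Nonempty := by
  obtain ⟨σ, hσ, -⟩ := exists_eq_smul_isState (PosSemidef.zero : (0 : Matrix α α ℂ).PosSemidef)
  obtain ⟨τ, hτ, -⟩ := exists_eq_smul_isState (PosSemidef.zero : (0 : Matrix β β ℂ).PosSemidef)
  exact ⟨_, hσ.kronecker_mem_separableStates hτ⟩

lemma isState_of_mem_separableStates {σ : Matrix (α × β) (α × β) ℂ}
    (hσ : σ ∈ separableStates α β) : IsState σ :=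
  ⟨posSemidef_of_mem_separableOperators (separableStates_subset hσ).1, (separableStates_subset hσ).2⟩

lemma convex_separableStates : Convex ℝ (separableStates α β) := convex_convexHull _ _

end States

/-- The other party. -/
def Party.other : Party → Party
  | .alice => .bob
  | .bob => .alice

/-! ### Closure properties of LOCC protocols. -/

namespace IsRoundLOCC

variable {α β : Type*} [Fintype α] [Fintype β] [DecidableEq α] [DecidableEq β]

lemma alice_sends {ι : Type*} [Fintype ι] {k : ℕ} (K : ι → Matrix α α ℂ)
    (M : ι → Matrix (α × β) (α × β) ℂ) (hK : ∑ j, (K j)ᴴ * K j = 1)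
    (hM : ∀ j, IsRoundLOCC Party.bob k (M j)) :
    IsRoundLOCC Party.alice (k + 1)
      (∑ j, (K j ⊗ₖ (1 : Matrix β β ℂ))ᴴ * M j * (K j ⊗ₖ (1 : Matrix β β ℂ))) := by
  let e := (Fintype.equivFin ι).symm
  rw [← e.sum_comp] at hK ⊢
  exact aliceSends k _ (fun j => K (e j)) (fun j => M (e j)) hK fun j => hM _

lemma bob_sends {ι : Type*} [Fintype ι] {k : ℕ} (K : ι → Matrix β β ℂ)
    (M : ι → Matrix (α × β) (α × β) ℂ) (hK : ∑ j, (K j)ᴴ * K j = 1)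
    (hM : ∀ j, IsRoundLOCC Party.alice k (M j)) :
    IsRoundLOCC Party.bob (k + 1)
      (∑ j, ((1 : Matrix α α ℂ) ⊗ₖ K j)ᴴ * M j * ((1 : Matrix α α ℂ) ⊗ₖ K j)) := by
  let e := (Fintype.equivFin ι).symm
  rw [← e.sum_comp] at hK ⊢
  exact bobSends k _ (fun j => K (e j)) (fun j => M (e j)) hK fun j => hM _

/-- Exchanging the two parties. -/
lemma swap {p : Party} {k : ℕ} {M : Matrix (α × β) (α × β) ℂ} (h : IsRoundLOCC p k M) :
    IsRoundLOCC p.other k (M.submatrix Prod.swap Prod.swap : Matrix (β × α) (β × α) ℂ) := by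
  have hsub : ∀ (P : Matrix α α ℂ) (Q : Matrix β β ℂ),
      ((P ⊗ₖ Q).submatrix Prod.swap Prod.swap : Matrix (β × α) (β × α) ℂ) = Q ⊗ₖ P := by
    intro P Q
    ext x y
    simp [mul_comm]
  have hmul : ∀ X Y : Matrix (α × β) (α × β) ℂ,
      ((X * Y).submatrix Prod.swap Prod.swap : Matrix (β × α) (β × α) ℂ)
        = X.submatrix Prod.swap Prod.swap * Y.submatrix Prod.swap Prod.swap := fun X Y =>
    (submatrix_mul_equiv X Y Prod.swap (Equiv.prodComm β α) Prod.swap).symm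
  have hsum : ∀ (m : ℕ) (X : Fin m → Matrix (α × β) (α × β) ℂ),
      ((∑ j, X j).submatrix Prod.swap Prod.swap : Matrix (β × α) (β × α) ℂ)
        = ∑ j, (X j).submatrix Prod.swap Prod.swap := by
    intro m X
    ext x y
    simp [Matrix.sum_apply]
  induction h with
  | aliceFinal E hE => rw [hsub]; exact bobFinal E hE
  | bobFinal E hE => rw [hsub]; exact aliceFinal E hE
  | aliceSends k m K M hK hM ih =>
    simp only [hsum, hmul, hsub, conjTranspose_kronecker]
    have := bobSends k m K _ hK ih
    simp only [conjTranspose_kronecker] at this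
    exact this
  | bobSends k m K M hK hM ih =>
    simp only [hsum, hmul, hsub, conjTranspose_kronecker]
    have := aliceSends k m K _ hK ih
    simp only [conjTranspose_kronecker] at this
    exact this

/-- A party may send a trivial message. -/
lemma other_succ {p : Party} {k : ℕ} {M : Matrix (α × β) (α × β) ℂ} (h : IsRoundLOCC p k M) :
    IsRoundLOCC p.other (k + 1) M := by
  cases p with
  | alice =>
    have := bob_sends (ι := Unit) (fun _ => 1) (fun _ => M) (by simp) fun _ => h
    simp only [Finset.univ_unique, Finset.sum_singleton, one_kronecker_one, conjTranspose_one,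
      Matrix.one_mul, Matrix.mul_one] at this
    exact this
  | bob =>
    have := alice_sends (ι := Unit) (fun _ => 1) (fun _ => M) (by simp) fun _ => h
    simp only [Finset.univ_unique, Finset.sum_singleton, one_kronecker_one, conjTranspose_one,
      Matrix.one_mul, Matrix.mul_one] at this
    exact this

lemma zero (p : Party) : IsRoundLOCC p 0 (0 : Matrix (α × β) (α × β) ℂ) := by
  cases p with
  | alice => simpa using aliceFinal (α := α) (β := β) 0 IsEffect.zero
  | bob => simpa using bobFinal (α := α) (β := β) 0 IsEffect.zero

lemma one (p : Party) : IsRoundLOCC p 0 (1 : Matrix (α × β) (α × β) ℂ) := by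
  cases p with
  | alice => simpa using aliceFinal (α := α) (β := β) 1 IsEffect.one
  | bob => simpa using bobFinal (α := α) (β := β) 1 IsEffect.one

/-- Alice measures `{E, 1 - E}` and sends the outcome. -/
lemma alice_measures {k : ℕ} {E : Matrix α α ℂ} (hE : IsEffect E)
    {N₁ N₀ : Matrix (α × β) (α × β) ℂ} (h₁ : IsRoundLOCC .bob k N₁) (h₀ : IsRoundLOCC .bob k N₀) :
    ∃ R S : Matrix α α ℂ, E = Rᴴ * R ∧ IsRoundLOCC .alice (k + 1)
      ((R ⊗ₖ (1 : Matrix β β ℂ))ᴴ * N₁ * (R ⊗ₖ (1 : Matrix β β ℂ)) +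
        (S ⊗ₖ (1 : Matrix β β ℂ))ᴴ * N₀ * (S ⊗ₖ (1 : Matrix β β ℂ))) := by
  obtain ⟨R, hR⟩ := exists_eq_conjTranspose_mul_self hE.1
  obtain ⟨S, hS⟩ := exists_eq_conjTranspose_mul_self hE.2
  refine ⟨R, S, hR, ?_⟩
  have := alice_sends (β := β) (k := k) (fun b : Bool => if b then R else S)
    (fun b => if b then N₁ else N₀) (by simp [← hR, ← hS]) (by simpa using ⟨h₀, h₁⟩)
  simpa using this

/-- The party who would decide can instead announce the outcome, after which the other party
deterministically answers `1` or `0`. -/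
lemma succ {p : Party} {k : ℕ} {M : Matrix (α × β) (α × β) ℂ} (h : IsRoundLOCC p k M) :
    IsRoundLOCC p (k + 1) M := by
  induction h with
  | aliceFinal E hE =>
    obtain ⟨R, S, hR, h⟩ := alice_measures (β := β) hE (one _) (zero _)
    simpa [conjTranspose_kronecker, ← mul_kronecker_mul, ← hR] using h
  | bobFinal E hE =>
    -- The same construction with the parties exchanged; `swap` carries it back.
    obtain ⟨R, S, hR, h⟩ := alice_measures (β := α) hE (one _) (zero _)
    have hE' : (1 : Matrix α α ℂ) ⊗ₖ E
        = (E ⊗ₖ (1 : Matrix α α ℂ)).submatrix Prod.swap Prod.swap := by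
      ext x y
      exact mul_comm _ _
    rw [hE']
    simp only [conjTranspose_kronecker, ← mul_kronecker_mul, ← hR, Matrix.mul_one, Matrix.mul_zero,
      Matrix.zero_mul, add_zero, conjTranspose_one] at h
    exact h.swap
  | aliceSends k m K M hK hM ih => exact aliceSends _ m K M hK ih
  | bobSends k m K M hK hM ih => exact bobSends _ m K M hK ih

lemma mono {p : Party} {k l : ℕ} (hkl : k ≤ l) {M : Matrix (α × β) (α × β) ℂ}
    (h : IsRoundLOCC p k M) : IsRoundLOCC p l M := by
  induction hkl with
  | refl => exact h
  | step _ ih => exact ih.succ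

/-- One extra round suffices: it pads the end if the first speaker is unchanged, and otherwise is a
trivial opening message. -/
lemma any_party {p : Party} {k : ℕ} {M : Matrix (α × β) (α × β) ℂ} (h : IsRoundLOCC p k M)
    (r : Party) : IsRoundLOCC r (k + 1) M := by
  cases p <;> cases r
  exacts [h.succ, h.other_succ, h.other_succ, h.succ]

/-- The complement has the same form, `1 - ∑ⱼ Kⱼᴴ Mⱼ Kⱼ = ∑ⱼ Kⱼᴴ (1 - Mⱼ) Kⱼ`, so both memberships
propagate together. -/
lemma separable {p : Party} {k : ℕ} {M : Matrix (α × β) (α × β) ℂ} (h : IsRoundLOCC p k M) :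
    M ∈ separableOperators α β ∧ 1 - M ∈ separableOperators α β := by
  induction h with
  | aliceFinal E hE =>
    refine ⟨kronecker_mem_separableOperators hE.1 PosSemidef.one, ?_⟩
    rw [← one_kronecker_one, ← sub_kronecker]
    exact kronecker_mem_separableOperators hE.2 PosSemidef.one
  | bobFinal E hE =>
    refine ⟨kronecker_mem_separableOperators PosSemidef.one hE.1, ?_⟩
    rw [← one_kronecker_one, ← kronecker_sub]
    exact kronecker_mem_separableOperators PosSemidef.one hE.2
  | aliceSends k m K M hK hM ih =>
    refine ⟨finsetSum_mem_separableOperators _ fun j _ => conj_mem_separableOperators (ih j).1 _ _, ?_⟩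
    have h1 : ∑ j, (K j ⊗ₖ (1 : Matrix β β ℂ))ᴴ * 1 * (K j ⊗ₖ (1 : Matrix β β ℂ)) = 1 := by
      simp only [Matrix.mul_one, conjTranspose_kronecker, ← mul_kronecker_mul, conjTranspose_one]
      rw [← one_kronecker_one, ← hK, sum_kronecker]
    rw [← h1, ← Finset.sum_sub_distrib]
    simp only [← Matrix.sub_mul, ← Matrix.mul_sub]
    exact finsetSum_mem_separableOperators _ fun j _ => conj_mem_separableOperators (ih j).2 _ _
  | bobSends k m K M hK hM ih =>
    refine ⟨finsetSum_mem_separableOperators _ fun j _ => conj_mem_separableOperators (ih j).1 _ _, ?_⟩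
    have h1 : ∑ j, ((1 : Matrix α α ℂ) ⊗ₖ K j)ᴴ * 1 * ((1 : Matrix α α ℂ) ⊗ₖ K j) = 1 := by
      simp only [Matrix.mul_one, conjTranspose_kronecker, ← mul_kronecker_mul, conjTranspose_one]
      rw [← one_kronecker_one, ← hK, kronecker_sum]
    rw [← h1, ← Finset.sum_sub_distrib]
    simp only [← Matrix.sub_mul, ← Matrix.mul_sub]
    exact finsetSum_mem_separableOperators _ fun j _ => conj_mem_separableOperators (ih j).2 _ _

/-- One may choose one of two protocols at random. -/
lemma convexCombination {k : ℕ} {M N : Matrix (α × β) (α × β) ℂ} {a b : ℝ}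
    (hM : IsRoundLOCC .bob k M) (hN : IsRoundLOCC .bob k N) (ha : 0 ≤ a) (hb : 0 ≤ b)
    (hab : a + b = 1) : IsRoundLOCC .alice (k + 1) (a • M + b • N) := by
  have hc : ∀ c : ℝ, 0 ≤ c → (Real.sqrt c : ℂ) * Real.sqrt c = c := fun c hc => by
    rw [← Complex.ofReal_mul, Real.mul_self_sqrt hc]
  have hs : ∀ (c : ℝ), 0 ≤ c → ∀ X : Matrix (α × β) (α × β) ℂ,
      (((Real.sqrt c : ℂ) • (1 : Matrix α α ℂ)) ⊗ₖ (1 : Matrix β β ℂ))ᴴ * X *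
        (((Real.sqrt c : ℂ) • (1 : Matrix α α ℂ)) ⊗ₖ (1 : Matrix β β ℂ)) = c • X := by
    intro c hc' X
    rw [smul_kronecker, one_kronecker_one, conjTranspose_smul, conjTranspose_one]
    simp only [Matrix.smul_mul, Matrix.mul_smul, Matrix.one_mul, Matrix.mul_one, smul_smul]
    have : star (Real.sqrt c : ℂ) = Real.sqrt c := Complex.conj_ofReal _
    rw [this, hc c hc']
    ext; simp
  -- The coin toss is the instrument with Kraus operators `√a · 1` and `√b · 1`.
  have := alice_sends (k := k)
    (fun i : Bool => if i then (Real.sqrt a : ℂ) • (1 : Matrix α α ℂ) else (Real.sqrt b : ℂ) • 1)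
    (fun i => if i then M else N) ?_ (by simpa using ⟨hN, hM⟩)
  · simp only [Fintype.sum_bool, if_true, Bool.false_eq_true, if_false, hs a ha, hs b hb] at this
    exact this
  · have : ∀ c : ℝ, star (Real.sqrt c : ℂ) = Real.sqrt c := fun c => Complex.conj_ofReal _
    simp only [Fintype.sum_bool, if_true, Bool.false_eq_true, if_false, conjTranspose_smul,
      conjTranspose_one, Matrix.smul_mul, Matrix.mul_smul, Matrix.one_mul, smul_smul, this, hc a ha,
      hc b hb, ← add_smul, ← Complex.ofReal_add, hab, Complex.ofReal_one, one_smul]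

end IsRoundLOCC
-- Running one protocol after another.
section Composition

variable {A B α α' β β' : Type*}

lemma joint_conj_left [Fintype A] [Fintype B] [Fintype α] [Fintype β] [Fintype α'] [Fintype β']
    [DecidableEq α'] [DecidableEq β'] (e : A ≃ α × α') (f : B ≃ β × β') (K : Matrix α α ℂ) (L : Matrix β β ℂ)
    (M : Matrix (α × β) (α × β) ℂ) (N : Matrix (α' × β') (α' × β') ℂ) :
    joint (pairEquiv e f) ((K ⊗ₖ L)ᴴ * M * (K ⊗ₖ L)) N
      = (joint e K 1 ⊗ₖ joint f L 1)ᴴ * joint (pairEquiv e f) M N * (joint e K 1 ⊗ₖ joint f L 1) := by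
  rw [← joint_pairEquiv_kronecker, joint_conjTranspose, joint_mul_joint, joint_mul_joint,
    one_kronecker_one, conjTranspose_one, Matrix.one_mul, Matrix.mul_one]

lemma sum_conjTranspose_joint_one {ι : Type*} [Fintype ι] [Fintype A] [Fintype α] [Fintype α']
    [DecidableEq A] [DecidableEq α] [DecidableEq α'] (e : A ≃ α × α') {K : ι → Matrix α α ℂ}
    (hK : ∑ j, (K j)ᴴ * K j = 1) :
    ∑ j, (joint e (K j) (1 : Matrix α' α' ℂ))ᴴ * joint e (K j) 1 = 1 := by
  simp only [joint_conjTranspose, joint_mul_joint, conjTranspose_one, Matrix.mul_one]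
  rw [← joint_sum_left, hK, joint_one_one]

/-- `{M, 1 - M}` is measured on one system; according to the outcome `N₁` or `N₀` is measured on
another one. -/
def conditional [DecidableEq α] [DecidableEq β] (e : A ≃ α × α') (f : B ≃ β × β') (M : Matrix (α × β) (α × β) ℂ)
    (N₁ N₀ : Matrix (α' × β') (α' × β') ℂ) : Matrix (A × B) (A × B) ℂ :=
  joint (pairEquiv e f) M N₁ + joint (pairEquiv e f) (1 - M) N₀

lemma one_sub_conditional [DecidableEq A] [DecidableEq B] [DecidableEq α] [DecidableEq β]
    [DecidableEq α'] [DecidableEq β'] (e : A ≃ α × α') (f : B ≃ β × β') (M : Matrix (α × β) (α × β) ℂ)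
    (N₁ N₀ : Matrix (α' × β') (α' × β') ℂ) :
    1 - conditional e f M N₁ N₀ = conditional e f M (1 - N₁) (1 - N₀) := by
  rw [conditional, conditional, joint_sub_right, joint_sub_right, ← joint_one_one (pairEquiv e f)]
  simp only [joint_sub_left]
  abel

lemma conditional_swap [DecidableEq α] [DecidableEq β] (e : A ≃ α × α') (f : B ≃ β × β') (M : Matrix (α × β) (α × β) ℂ)
    (N₁ N₀ : Matrix (α' × β') (α' × β') ℂ) :
    (conditional e f M N₁ N₀).submatrix Prod.swap Prod.swap
      = conditional f e (M.submatrix Prod.swap Prod.swap) (N₁.submatrix Prod.swap Prod.swap)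
          (N₀.submatrix Prod.swap Prod.swap) := by
  have h : (1 : Matrix (β × α) (β × α) ℂ)
      = (1 : Matrix (α × β) (α × β) ℂ).submatrix Prod.swap Prod.swap := by
    rw [submatrix_one _ Prod.swap_injective]
  rw [conditional, conditional, h]
  rfl

variable [Fintype A] [Fintype B] [Fintype α] [Fintype β] [Fintype α'] [Fintype β'] [DecidableEq α]
  [DecidableEq β] [DecidableEq α'] [DecidableEq β']

lemma conditional_eq_sum {ι : Type*} [Fintype ι] (e : A ≃ α × α') (f : B ≃ β × β')
    (K : ι → Matrix α α ℂ) (L : ι → Matrix β β ℂ) (M : ι → Matrix (α × β) (α × β) ℂ)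
    (hKL : ∑ j, (K j ⊗ₖ L j)ᴴ * (K j ⊗ₖ L j) = 1) (N₁ N₀ : Matrix (α' × β') (α' × β') ℂ) :
    conditional e f (∑ j, (K j ⊗ₖ L j)ᴴ * M j * (K j ⊗ₖ L j)) N₁ N₀
      = ∑ j, (joint e (K j) 1 ⊗ₖ joint f (L j) 1)ᴴ * conditional e f (M j) N₁ N₀ *
          (joint e (K j) 1 ⊗ₖ joint f (L j) 1) := by
  have h : 1 - ∑ j, (K j ⊗ₖ L j)ᴴ * M j * (K j ⊗ₖ L j)
      = ∑ j, (K j ⊗ₖ L j)ᴴ * (1 - M j) * (K j ⊗ₖ L j) := by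
    conv_lhs => rw [← hKL, ← Finset.sum_sub_distrib]
    simp only [Matrix.mul_sub, Matrix.sub_mul, Matrix.mul_one]
  simp only [conditional]
  rw [h, joint_sum_left, joint_sum_left, ← Finset.sum_add_distrib]
  simp only [joint_conj_left, Matrix.mul_add, Matrix.add_mul]

variable [DecidableEq A] [DecidableEq B]

/-- Alice's final decision becomes a message, and Bob opens the continuation on the second system.
-/
lemma conditional_alice_final (e : A ≃ α × α') (f : B ≃ β × β') {l : ℕ}
    {N₁ N₀ : Matrix (α' × β') (α' × β') ℂ} {E : Matrix α α ℂ} (hE : IsEffect E)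
    (h₁ : IsRoundLOCC .bob l (joint (pairEquiv e f) (1 : Matrix (α × β) (α × β) ℂ) N₁))
    (h₀ : IsRoundLOCC .bob l (joint (pairEquiv e f) (1 : Matrix (α × β) (α × β) ℂ) N₀)) :
    IsRoundLOCC .alice (l + 1) (conditional e f (E ⊗ₖ (1 : Matrix β β ℂ)) N₁ N₀) := by
  obtain ⟨R, hR⟩ := exists_eq_conjTranspose_mul_self hE.1
  obtain ⟨S, hS⟩ := exists_eq_conjTranspose_mul_self hE.2
  have h := IsRoundLOCC.alice_sends (k := l)
    (fun b : Bool => joint e (if b then R else S) (1 : Matrix α' α' ℂ))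
    (fun b => joint (pairEquiv e f) (1 : Matrix (α × β) (α × β) ℂ) (if b then N₁ else N₀))
    (sum_conjTranspose_joint_one e (by simp [← hR, ← hS]))
    (by simpa using ⟨h₀, h₁⟩)
  have hone : (1 : Matrix B B ℂ) = joint f (1 : Matrix β β ℂ) (1 : Matrix β' β' ℂ) :=
    (joint_one_one f).symm
  rw [hone] at h
  simp only [Fintype.sum_bool, if_true, Bool.false_eq_true, if_false] at h
  rw [← joint_conj_left, ← joint_conj_left] at h
  simp only [Matrix.mul_one, conjTranspose_kronecker, ← mul_kronecker_mul, conjTranspose_one, ← hR,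
    ← hS] at h
  rw [sub_kronecker, one_kronecker_one] at h
  exact h

/-- A protocol on one of two systems is a protocol on the joint system. -/
lemma IsRoundLOCC.joint_one_left (e : A ≃ α × α') (f : B ≃ β × β') {p : Party} {k : ℕ}
    {N : Matrix (α' × β') (α' × β') ℂ} (h : IsRoundLOCC p k N) :
    IsRoundLOCC p k (joint (pairEquiv e f) (1 : Matrix (α × β) (α × β) ℂ) N) := by
  have key : ∀ (K : Matrix α' α' ℂ) (L : Matrix β' β' ℂ) (X : Matrix (α' × β') (α' × β') ℂ),
      joint (pairEquiv e f) (1 : Matrix (α × β) (α × β) ℂ) ((K ⊗ₖ L)ᴴ * X * (K ⊗ₖ L))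
        = (joint e 1 K ⊗ₖ joint f 1 L)ᴴ * joint (pairEquiv e f) 1 X * (joint e 1 K ⊗ₖ joint f 1 L) := by
    intro K L X
    rw [← joint_pairEquiv_kronecker, joint_conjTranspose, joint_mul_joint, joint_mul_joint,
      one_kronecker_one, conjTranspose_one, Matrix.one_mul, Matrix.mul_one]
  induction h with
  | aliceFinal E hE =>
    rw [← one_kronecker_one, joint_pairEquiv_kronecker, joint_one_one]
    refine aliceFinal _ ⟨joint_posSemidef _ PosSemidef.one hE.1, ?_⟩
    rw [← joint_one_one e, ← joint_sub_right]
    exact joint_posSemidef _ PosSemidef.one hE.2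
  | bobFinal E hE =>
    rw [← one_kronecker_one, joint_pairEquiv_kronecker, joint_one_one]
    refine bobFinal _ ⟨joint_posSemidef _ PosSemidef.one hE.1, ?_⟩
    rw [← joint_one_one f, ← joint_sub_right]
    exact joint_posSemidef _ PosSemidef.one hE.2
  | aliceSends k m K M hK hM ih =>
    simp only [joint_sum_right, key, joint_one_one]
    refine aliceSends k m (fun j => joint e 1 (K j)) _ ?_ ih
    simp only [joint_conjTranspose, joint_mul_joint, conjTranspose_one, Matrix.mul_one]
    rw [← joint_sum_right, hK, joint_one_one]
  | bobSends k m K M hK hM ih =>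
    simp only [joint_sum_right, key, joint_one_one]
    refine bobSends k m (fun j => joint f 1 (K j)) _ ?_ ih
    simp only [joint_conjTranspose, joint_mul_joint, conjTranspose_one, Matrix.mul_one]
    rw [← joint_sum_right, hK, joint_one_one]

/-- The continuation is attached to the leaves of the first protocol. Which party reaches the leaf
depends on `p` and the parity of `k`, hence the assumption for every opening party; the former final
decision costs the extra round in `l + 1 + k`. -/
lemma IsRoundLOCC.conditional (e : A ≃ α × α') (f : B ≃ β × β') {p : Party} {k l : ℕ}
    {M : Matrix (α × β) (α × β) ℂ} (hM : IsRoundLOCC p k M)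
    {N₁ N₀ : Matrix (α' × β') (α' × β') ℂ} (h₁ : ∀ r, IsRoundLOCC r l N₁)
    (h₀ : ∀ r, IsRoundLOCC r l N₀) :
    IsRoundLOCC p (l + 1 + k) (conditional e f M N₁ N₀) := by
  induction hM with
  | aliceFinal E hE =>
    exact conditional_alice_final e f hE ((h₁ _).joint_one_left e f) ((h₀ _).joint_one_left e f)
  | bobFinal E hE =>
    have hs := (conditional_alice_final f e hE ((h₁ .alice).swap.joint_one_left f e)
      ((h₀ .alice).swap.joint_one_left f e)).swap
    rw [conditional_swap] at hs
    have hE' : (E ⊗ₖ (1 : Matrix α α ℂ)).submatrix Prod.swap Prod.swap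
        = (1 : Matrix α α ℂ) ⊗ₖ E := by
      ext x y
      exact mul_comm _ _
    rw [hE'] at hs
    exact hs
  | aliceSends k m K M hK hM ih =>
    rw [conditional_eq_sum e f K (fun _ => 1)]
    · simp only [joint_one_one]
      exact aliceSends _ m _ _ (sum_conjTranspose_joint_one e hK) ih
    · simp only [conjTranspose_kronecker, ← mul_kronecker_mul, conjTranspose_one, Matrix.mul_one]
      rw [← sum_kronecker, hK, one_kronecker_one]
  | bobSends k m K M hK hM ih =>
    rw [conditional_eq_sum e f (fun _ => 1) K]
    · simp only [joint_one_one]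
      exact bobSends _ m _ _ (sum_conjTranspose_joint_one f hK) ih
    · simp only [conjTranspose_kronecker, ← mul_kronecker_mul, conjTranspose_one, Matrix.mul_one]
      rw [← kronecker_sum, hK, one_kronecker_one]

end Composition

/-! ### Counting outcomes on many copies. -/

section Threshold

variable {α β : Type*} [DecidableEq α] [DecidableEq β]

/-- The identification of `α^{n+1}` with `α × αⁿ`. -/
def tupleEquiv (α : Type*) (n : ℕ) : (Fin (n + 1) → α) ≃ α × (Fin n → α) :=
  (Fin.consEquiv fun _ => α).symm

/-- `{M, 1 - M}` is measured on each of `n` copies; the test accepts if the number of the outcomes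
`M` is at least `t`. -/
noncomputable def thresholdTest (M : Matrix (α × β) (α × β) ℂ) :
    (n : ℕ) → ℝ → Matrix ((Fin n → α) × (Fin n → β)) ((Fin n → α) × (Fin n → β)) ℂ
  | 0, t => if t ≤ 0 then 1 else 0
  | n + 1, t => conditional (tupleEquiv α n) (tupleEquiv β n) M (thresholdTest M n (t - 1))
      (thresholdTest M n t)

lemma thresholdTest_swap (M : Matrix (α × β) (α × β) ℂ) (n : ℕ) (t : ℝ) :
    (thresholdTest M n t).submatrix Prod.swap Prod.swap
      = thresholdTest (M.submatrix Prod.swap Prod.swap) n t := by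
  induction n generalizing t with
  | zero =>
    simp only [thresholdTest]
    split_ifs
    · exact submatrix_one _ Prod.swap_injective
    · rfl
  | succ n ih => rw [thresholdTest, conditional_swap, ih, ih, thresholdTest]

variable [Fintype α] [Fintype β]

lemma thresholdTest_separable {M : Matrix (α × β) (α × β) ℂ}
    (hM : M ∈ separableOperators α β) (hM' : 1 - M ∈ separableOperators α β) (n : ℕ) (t : ℝ) :
    thresholdTest M n t ∈ separableOperators (Fin n → α) (Fin n → β) ∧
      1 - thresholdTest M n t ∈ separableOperators (Fin n → α) (Fin n → β) := by
  induction n generalizing t with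
  | zero =>
    simp only [thresholdTest]
    split_ifs
    · simpa using ⟨one_mem_separableOperators, zero_mem_separableOperators⟩
    · simpa using ⟨zero_mem_separableOperators, one_mem_separableOperators⟩
  | succ n ih =>
    rw [thresholdTest, one_sub_conditional]
    exact ⟨add_mem_separableOperators (joint_mem_separableOperators _ _ hM (ih _).1)
        (joint_mem_separableOperators _ _ hM' (ih _).1),
      add_mem_separableOperators (joint_mem_separableOperators _ _ hM (ih _).2)
        (joint_mem_separableOperators _ _ hM' (ih _).2)⟩

lemma thresholdTest_locc {M : Matrix (α × β) (α × β) ℂ} {k : ℕ} (hM : IsRoundLOCC .alice k M)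
    (n : ℕ) (t : ℝ) : ∃ l, ∀ r, IsRoundLOCC r l (thresholdTest M n t) := by
  induction n generalizing t with
  | zero =>
    refine ⟨0, fun r => ?_⟩
    simp only [thresholdTest]
    split_ifs
    exacts [.one r, .zero r]
  | succ n ih =>
    obtain ⟨l₁, h₁⟩ := ih (t - 1)
    obtain ⟨l₀, h₀⟩ := ih t
    rw [thresholdTest]
    -- The two continuations are padded to a common length, and a last extra round frees the choice
    -- of the opening party.
    exact ⟨_, (hM.conditional _ _ (l := max l₁ l₀) (fun r => (h₁ r).mono (le_max_left _ _))
      fun r => (h₀ r).mono (le_max_right _ _)).any_party⟩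

lemma isRoundLOCC_bob_zero_iff {M : Matrix (α × β) (α × β) ℂ} :
    IsRoundLOCC .bob 0 M ↔ ∃ E : Matrix β β ℂ, IsEffect E ∧ M = 1 ⊗ₖ E :=
  ⟨fun h => by cases h with | bobFinal E hE => exact ⟨E, hE, rfl⟩,
    fun ⟨E, hE, h⟩ => h ▸ .bobFinal E hE⟩

/-- One-way measurements: Alice measures, and Bob measures an effect which depends on the
outcome. -/
lemma isRoundLOCC_alice_one_iff {M : Matrix (α × β) (α × β) ℂ} :
    IsRoundLOCC .alice 1 M ↔ ∃ (m : ℕ) (K : Fin m → Matrix α α ℂ) (E : Fin m → Matrix β β ℂ),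
      ∑ j, (K j)ᴴ * K j = 1 ∧ (∀ j, IsEffect (E j)) ∧ M = ∑ j, ((K j)ᴴ * K j) ⊗ₖ E j := by
  constructor
  · intro h
    cases h with
    | aliceSends k m K N hK hN =>
      choose E hE hNE using fun j => isRoundLOCC_bob_zero_iff.1 (hN j)
      refine ⟨m, K, E, hK, hE, ?_⟩
      simp [hNE, conjTranspose_kronecker, ← mul_kronecker_mul]
  · rintro ⟨m, K, E, hK, hE, rfl⟩
    have := IsRoundLOCC.aliceSends 0 m K _ hK fun j => .bobFinal (α := α) (E j) (hE j)
    simpa [conjTranspose_kronecker, ← mul_kronecker_mul] using this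

/-- General composition would add rounds. Here Alice's instrument never depends on earlier outcomes,
so she can measure all copies at once and leave the whole counting to Bob. The instrument is chosen
before `t`, so that the continuations with thresholds `t - 1` and `t` can share it in the induction.
-/
lemma thresholdTest_oneWay {M : Matrix (α × β) (α × β) ℂ} (hM : IsRoundLOCC .alice 1 M) (n : ℕ) :
    ∃ (ι : Type) (_ : Fintype ι) (L : ι → Matrix (Fin n → α) (Fin n → α) ℂ),
      ∑ i, (L i)ᴴ * L i = 1 ∧ ∀ t, ∃ F : ι → Matrix (Fin n → β) (Fin n → β) ℂ,
        (∀ i, IsEffect (F i)) ∧ thresholdTest M n t = ∑ i, ((L i)ᴴ * L i) ⊗ₖ F i := by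
  induction n with
  | zero =>
    refine ⟨Unit, inferInstance, fun _ => 1, by simp, fun t => ?_⟩
    refine ⟨fun _ => if t ≤ 0 then 1 else 0, fun _ => ?_, ?_⟩
    · split_ifs
      exacts [.one, .zero]
    · simp only [thresholdTest]
      split_ifs <;> simp
  | succ n ih =>
    obtain ⟨m, K, E, hK, hE, hMK⟩ := isRoundLOCC_alice_one_iff.1 hM
    obtain ⟨ι, _, L, hL, hF⟩ := ih
    have hLL : ∀ j i, (joint (tupleEquiv α n) (K j) (L i))ᴴ * joint (tupleEquiv α n) (K j) (L i)
        = joint (tupleEquiv α n) ((K j)ᴴ * K j) ((L i)ᴴ * L i) := fun j i => by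
      rw [joint_conjTranspose, joint_mul_joint]
    refine ⟨Fin m × ι, inferInstance, fun x => joint (tupleEquiv α n) (K x.1) (L x.2), ?_,
      fun t => ?_⟩
    · simp only [hLL, Fintype.sum_prod_type, ← joint_sum_right, ← joint_sum_left, hL, hK,
        joint_one_one]
    · obtain ⟨F₁, hF₁, hT₁⟩ := hF (t - 1)
      obtain ⟨F₀, hF₀, hT₀⟩ := hF t
      -- Bob measures `E` on the first copy and, according to the outcome, `F₁` or `F₀` on the rest.
      refine ⟨fun x => joint (tupleEquiv β n) (E x.1) (F₁ x.2) +
        joint (tupleEquiv β n) (1 - E x.1) (F₀ x.2), fun x => ⟨?_, ?_⟩, ?_⟩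
      · exact (joint_posSemidef _ (hE _).1 (hF₁ _).1).add (joint_posSemidef _ (hE _).2 (hF₀ _).1)
      · have : 1 - (joint (tupleEquiv β n) (E x.1) (F₁ x.2) +
            joint (tupleEquiv β n) (1 - E x.1) (F₀ x.2))
            = joint (tupleEquiv β n) (E x.1) (1 - F₁ x.2) +
              joint (tupleEquiv β n) (1 - E x.1) (1 - F₀ x.2) := by
          rw [← joint_one_one (tupleEquiv β n)]
          simp only [joint_sub_left, joint_sub_right]
          abel
        rw [this]
        exact (joint_posSemidef _ (hE _).1 (hF₁ _).2).add (joint_posSemidef _ (hE _).2 (hF₀ _).2)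
      · have hM1 : 1 - M = ∑ j, ((K j)ᴴ * K j) ⊗ₖ (1 - E j) := by
          simp only [kronecker_sub, Finset.sum_sub_distrib]
          rw [← sum_kronecker, hK, one_kronecker_one, hMK]
        rw [thresholdTest, conditional, hT₁, hT₀, hM1, hMK]
        simp only [joint_sum_left, joint_sum_right, joint_pairEquiv_kronecker, hLL,
          Fintype.sum_prod_type, kronecker_add, Finset.sum_add_distrib]
        congr 1 <;> exact Finset.sum_comm

lemma thresholdTest_alice_one {M : Matrix (α × β) (α × β) ℂ} (hM : IsRoundLOCC .alice 1 M) (n : ℕ)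
    (t : ℝ) : IsRoundLOCC .alice 1 (thresholdTest M n t) := by
  obtain ⟨ι, _, L, hL, hF⟩ := thresholdTest_oneWay hM n
  obtain ⟨F, hF, hT⟩ := hF t
  have := IsRoundLOCC.alice_sends L _ hL fun i => .bobFinal (α := Fin n → α) (F i) (hF i)
  simpa [hT, conjTranspose_kronecker, ← mul_kronecker_mul] using this

end Threshold

/-! ### The properties shared by the four classes. -/

section Classes

variable {α β : Type*} [Fintype α] [Fintype β] [DecidableEq α] [DecidableEq β]

lemma MeasurementClass.separable_of_mem (C : MeasurementClass) {M : Matrix (α × β) (α × β) ℂ}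
    (hM : M ∈ C.effects α β) : M ∈ separableOperators α β ∧ 1 - M ∈ separableOperators α β := by
  cases C with
  | oneWayAliceToBob => exact IsRoundLOCC.separable hM
  | oneWayBobToAlice => exact IsRoundLOCC.separable hM
  | locc => exact hM.choose_spec.separable
  | sep => exact hM

lemma MeasurementClass.one_mem (C : MeasurementClass) : 1 ∈ C.effects α β := by
  cases C with
  | oneWayAliceToBob => exact (IsRoundLOCC.one _).succ
  | oneWayBobToAlice => exact (IsRoundLOCC.one _).succ
  | locc => exact ⟨0, .one _⟩
  | sep => exact ⟨one_mem_separableOperators, by simpa using zero_mem_separableOperators⟩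

/-- To avoid an extra round, the coin is absorbed into Alice's instrument: the disjoint union of
both Kraus families, scaled by `√a` and `√b`. -/
lemma IsRoundLOCC.convexCombination_alice_one {M N : Matrix (α × β) (α × β) ℂ} {a b : ℝ}
    (hM : IsRoundLOCC .alice 1 M) (hN : IsRoundLOCC .alice 1 N) (ha : 0 ≤ a) (hb : 0 ≤ b)
    (hab : a + b = 1) : IsRoundLOCC .alice 1 (a • M + b • N) := by
  obtain ⟨m, K, E, hK, hE, rfl⟩ := isRoundLOCC_alice_one_iff.1 hM
  obtain ⟨m', L, F, hL, hF, rfl⟩ := isRoundLOCC_alice_one_iff.1 hN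
  have hc : ∀ c : ℝ, 0 ≤ c → ∀ X : Matrix α α ℂ,
      ((Real.sqrt c : ℂ) • X)ᴴ * ((Real.sqrt c : ℂ) • X) = c • (Xᴴ * X) := fun c hc X => by
    have : star (Real.sqrt c : ℂ) = Real.sqrt c := Complex.conj_ofReal _
    rw [conjTranspose_smul, this, Matrix.smul_mul, Matrix.mul_smul, smul_smul,
      ← Complex.ofReal_mul, Real.mul_self_sqrt hc]
    ext; simp
  have := IsRoundLOCC.alice_sends (k := 0)
    (Sum.elim (fun j => (Real.sqrt a : ℂ) • K j) fun j => (Real.sqrt b : ℂ) • L j)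
    (fun j => (1 : Matrix α α ℂ) ⊗ₖ Sum.elim E F j)
    (by simp only [Fintype.sum_sum_type, Sum.elim_inl, Sum.elim_inr, hc a ha, hc b hb,
          ← Finset.smul_sum, hK, hL, ← add_smul, hab, one_smul])
    (by rintro (j | j); exacts [.bobFinal _ (hE j), .bobFinal _ (hF j)])
  simp only [Fintype.sum_sum_type, Sum.elim_inl, Sum.elim_inr, conjTranspose_kronecker,
    ← mul_kronecker_mul, conjTranspose_one, Matrix.one_mul, Matrix.mul_one, hc a ha, hc b hb,
    smul_kronecker, ← Finset.smul_sum] at this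
  exact this

lemma MeasurementClass.convex_effects (C : MeasurementClass) : Convex ℝ (C.effects α β) := by
  intro M hM N hN a b ha hb hab
  cases C with
  | oneWayAliceToBob => exact IsRoundLOCC.convexCombination_alice_one hM hN ha hb hab
  | oneWayBobToAlice =>
    exact (IsRoundLOCC.convexCombination_alice_one (IsRoundLOCC.swap hM) (IsRoundLOCC.swap hN)
      ha hb hab).swap
  | locc =>
    obtain ⟨k, hM⟩ := hM
    obtain ⟨l, hN⟩ := hN
    exact ⟨_, .convexCombination ((hM.mono (le_max_left k l)).any_party .bob)
      ((hN.mono (le_max_right k l)).any_party .bob) ha hb hab⟩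
  | sep =>
    refine ⟨add_mem_separableOperators (smul_mem_separableOperators ha hM.1)
      (smul_mem_separableOperators hb hN.1), ?_⟩
    have : 1 - (a • M + b • N) = a • (1 - M) + b • (1 - N) := by
      rw [smul_sub, smul_sub, sub_add_sub_comm, ← add_smul, hab, one_smul]
    rw [this]
    exact add_mem_separableOperators (smul_mem_separableOperators ha hM.2)
      (smul_mem_separableOperators hb hN.2)

lemma MeasurementClass.thresholdTest_mem (C : MeasurementClass) {M : Matrix (α × β) (α × β) ℂ}
    (hM : M ∈ C.effects α β) (n : ℕ) (t : ℝ) :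
    thresholdTest M n t ∈ C.effects (Fin n → α) (Fin n → β) := by
  cases C with
  | oneWayAliceToBob => exact thresholdTest_alice_one hM n t
  | oneWayBobToAlice =>
    have := (thresholdTest_alice_one (IsRoundLOCC.swap hM) n t).swap
    rw [thresholdTest_swap] at this
    exact this
  | locc =>
    obtain ⟨k, hM⟩ := hM
    obtain ⟨l, hl⟩ := thresholdTest_locc hM n t
    exact ⟨l, hl _⟩
  | sep => exact thresholdTest_separable hM.1 hM.2 n t

end Classes

/-! ### Chernoff bounds for the two kinds of error. -/

section ErrorBounds

variable {α β : Type*}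

lemma tensorPower_succ (ρ : Matrix (α × β) (α × β) ℂ) (n : ℕ) :
    tensorPower ρ (n + 1)
      = joint (pairEquiv (tupleEquiv α n) (tupleEquiv β n)) ρ (tensorPower ρ n) := by
  ext x y
  simp only [tensorPower, Matrix.of_apply, Fin.prod_univ_succ, joint_apply]
  rfl

variable [Fintype α] [Fintype β]

lemma isState_tensorPower {ρ : Matrix (α × β) (α × β) ℂ} (hρ : IsState ρ) (n : ℕ) :
    IsState (tensorPower ρ n) := by
  classical
  induction n with
  | zero =>
    have : tensorPower ρ 0 = 1 := by
      ext x y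
      rw [Subsingleton.elim x y]
      simp [tensorPower]
    rw [this]
    exact ⟨PosSemidef.one, by simp⟩
  | succ n ih =>
    rw [tensorPower_succ]
    exact ⟨joint_posSemidef _ hρ.1 ih.1, by rw [trace_joint, hρ.2, ih.2, one_mul]⟩

lemma trace_re_nonneg {ι : Type*} [Fintype ι] {M X : Matrix ι ι ℂ} (hM : M.PosSemidef)
    (hX : X.PosSemidef) : 0 ≤ (M * X).trace.re :=
  (Complex.le_def.1 (trace_mul_nonneg hM hX)).1

lemma trace_one_sub_mul {ι : Type*} [Fintype ι] [DecidableEq ι] (M X : Matrix ι ι ℂ) :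
    ((1 - M) * X).trace.re = X.trace.re - (M * X).trace.re := by
  rw [Matrix.sub_mul, Matrix.one_mul, trace_sub, Complex.sub_re]

variable [DecidableEq α] [DecidableEq β]

/-- The Chernoff bound for the probability that a threshold test accepts a separable operator. -/
lemma trace_thresholdTest_mul_le {M : Matrix (α × β) (α × β) ℂ}
    (hM : M ∈ separableOperators α β) (hM' : 1 - M ∈ separableOperators α β) {s c : ℝ}
    (hs : 0 ≤ s) (hc : 0 ≤ c)
    (h : ∀ X ∈ separableOperators α β,
      Real.exp s * (M * X).trace.re + ((1 - M) * X).trace.re ≤ c * X.trace.re)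
    (n : ℕ) (t : ℝ) {X : Matrix ((Fin n → α) × (Fin n → β)) ((Fin n → α) × (Fin n → β)) ℂ}
    (hX : X ∈ separableOperators (Fin n → α) (Fin n → β)) :
    (thresholdTest M n t * X).trace.re ≤ Real.exp (-(s * t)) * c ^ n * X.trace.re := by
  induction n generalizing t with
  | zero =>
    have htr : 0 ≤ X.trace.re :=
      (Complex.le_def.1 (posSemidef_of_mem_separableOperators hX).trace_nonneg).1
    simp only [thresholdTest, pow_zero, mul_one]
    split_ifs with ht
    · rw [Matrix.one_mul]
      have : 1 ≤ Real.exp (-(s * t)) :=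
        Real.one_le_exp (by nlinarith [mul_nonneg hs (neg_nonneg.2 ht)])
      exact le_mul_of_one_le_left htr this
    · simp only [Matrix.zero_mul, trace_zero, Complex.zero_re]
      positivity
  | succ n ih =>
    let e := pairEquiv (tupleEquiv α n) (tupleEquiv β n)
    -- The marginal on the first copy, separable because the identity is a separable effect.
    have hY : contract (e.trans (Equiv.prodComm _ _)) 1 X ∈ separableOperators α β :=
      contract_mem_separableOperators ((tupleEquiv α n).trans (Equiv.prodComm _ _))
        ((tupleEquiv β n).trans (Equiv.prodComm _ _)) one_mem_separableOperators hX
    have h₁ := ih (t - 1) (contract_mem_separableOperators (tupleEquiv α n) (tupleEquiv β n) hM hX)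
    have h₀ := ih t (contract_mem_separableOperators (tupleEquiv α n) (tupleEquiv β n) hM' hX)
    rw [trace_contract] at h₁ h₀
    have hXY : X.trace = (contract (e.trans (Equiv.prodComm _ _)) 1 X).trace := by
      have := trace_joint_mul e (1 : Matrix (α × β) (α × β) ℂ)
        (1 : Matrix ((Fin n → α) × (Fin n → β)) ((Fin n → α) × (Fin n → β)) ℂ) X
      rw [joint_one_one, Matrix.one_mul, Matrix.one_mul, trace_contract, Matrix.one_mul] at this
      exact this
    -- The outcome `M` lowers the remaining threshold by one, which produces the weight `exp s` in
    -- the hypothesis `h`.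
    have hexp : Real.exp (-(s * (t - 1))) = Real.exp (-(s * t)) * Real.exp s := by
      rw [← Real.exp_add]
      ring_nf
    rw [thresholdTest, conditional, Matrix.add_mul, trace_add, trace_joint_mul, trace_joint_mul,
      Complex.add_re]
    calc _ ≤ _ := add_le_add h₁ h₀
      _ = Real.exp (-(s * t)) * c ^ n * (Real.exp s *
            (M * contract (e.trans (Equiv.prodComm _ _)) 1 X).trace.re +
            ((1 - M) * contract (e.trans (Equiv.prodComm _ _)) 1 X).trace.re) := by
        rw [hexp]; ring
      _ ≤ Real.exp (-(s * t)) * c ^ n *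
            (c * (contract (e.trans (Equiv.prodComm _ _)) 1 X).trace.re) :=
        mul_le_mul_of_nonneg_left (h _ hY) (by positivity)
      _ = _ := by rw [← hXY]; ring

/-- The Chernoff bound for the probability that a threshold test rejects `ρ^{⊗ n}`. -/
lemma trace_one_sub_thresholdTest_mul_le {M ρ : Matrix (α × β) (α × β) ℂ} (hM : M.PosSemidef)
    (hM' : (1 - M).PosSemidef) (hρ : IsState ρ) {s : ℝ} (hs : 0 ≤ s) (n : ℕ) (t : ℝ) :
    ((1 - thresholdTest M n t) * tensorPower ρ n).trace.re ≤
      Real.exp (s * t) * ((M * ρ).trace.re * Real.exp (-s) + (1 - (M * ρ).trace.re)) ^ n := by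
  have hp := trace_re_nonneg hM hρ.1
  have hp' := trace_re_nonneg hM' hρ.1
  -- Vanishing imaginary parts make the real part of a product of traces the product of the real
  -- parts.
  have him := (Complex.le_def.1 (trace_mul_nonneg hM hρ.1)).2
  have him' := (Complex.le_def.1 (trace_mul_nonneg hM' hρ.1)).2
  have hone := trace_one_sub_mul M ρ
  rw [hρ.2, Complex.one_re] at hone
  induction n generalizing t with
  | zero =>
    have h1 := (isState_tensorPower hρ 0).2
    simp only [thresholdTest, pow_zero, mul_one]
    split_ifs with ht
    · simp only [sub_self, Matrix.zero_mul, trace_zero, Complex.zero_re]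
      positivity
    · rw [sub_zero, Matrix.one_mul, h1, Complex.one_re]
      exact Real.one_le_exp (mul_nonneg hs (not_le.1 ht).le)
  | succ n ih =>
    have hexp : Real.exp (s * (t - 1)) = Real.exp (s * t) * Real.exp (-s) := by
      rw [← Real.exp_add]
      ring_nf
    rw [thresholdTest, one_sub_conditional, conditional, tensorPower_succ, Matrix.add_mul,
      joint_mul_joint, joint_mul_joint, trace_add, trace_joint, trace_joint, Complex.add_re,
      Complex.mul_re, Complex.mul_re, ← him, ← him', Complex.zero_im, zero_mul, zero_mul, sub_zero,
      sub_zero]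
    calc _ ≤ _ := add_le_add (mul_le_mul_of_nonneg_left (ih (t - 1)) hp)
          (mul_le_mul_of_nonneg_left (ih t) hp')
      _ = _ := by rw [hexp, hone]; ring

/-- Symmetrisation: for independent Bernoulli variables `X`, `X'` of mean `p`, Jensen gives `1 ≤ E
exp(-s(X' - p))`. Multiplying by this factor replaces `X` by the symmetric `X - X'` with values in
`{-1, 0, 1}`, whose moment generating function is at most `cosh s ≤ exp(s²/2)`. -/
lemma bernoulli_mgf_le {p : ℝ} (hp : 0 ≤ p) (hp' : p ≤ 1) (s : ℝ) :
    p * Real.exp s + (1 - p) ≤ Real.exp (p * s + s ^ 2 / 2) := by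
  have h1 : 1 ≤ p * Real.exp (-s + p * s) + (1 - p) * Real.exp (p * s) := by
    have := Real.add_one_le_exp (-s + p * s)
    have := Real.add_one_le_exp (p * s)
    nlinarith
  have h2 : (p * Real.exp s + (1 - p)) * (p * Real.exp (-s + p * s) + (1 - p) * Real.exp (p * s))
      ≤ Real.exp (p * s) * Real.cosh s := by
    rw [Real.exp_add, Real.cosh_eq]
    have h3 : Real.exp s * Real.exp (-s) = 1 := by rw [← Real.exp_add]; simp
    have h4 : (p * Real.exp s + (1 - p)) * (p * (Real.exp (-s) * Real.exp (p * s)) +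
        (1 - p) * Real.exp (p * s)) = Real.exp (p * s) * (p ^ 2 * (Real.exp s * Real.exp (-s)) +
          (1 - p) ^ 2 + p * (1 - p) * (Real.exp s + Real.exp (-s))) := by ring
    rw [h4, h3]
    refine mul_le_mul_of_nonneg_left ?_ (Real.exp_pos _).le
    have h5 : 2 ≤ Real.exp s + Real.exp (-s) := by
      have := Real.one_le_cosh s
      rw [Real.cosh_eq] at this
      linarith
    nlinarith [mul_nonneg (sq_nonneg (1 - 2 * p)) (sub_nonneg.2 h5)]
  have h0 : 0 ≤ p * Real.exp s + (1 - p) := by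
    have := Real.exp_pos s
    have := sub_nonneg.2 hp'
    positivity
  calc _ ≤ _ := le_mul_of_one_le_right h0 h1
    _ ≤ _ := h2
    _ ≤ Real.exp (p * s) * Real.exp (s ^ 2 / 2) :=
      mul_le_mul_of_nonneg_left (Real.cosh_le_exp_half_sq s) (Real.exp_pos _).le
    _ = _ := by rw [← Real.exp_add]

end ErrorBounds

/-! ### One measurement against all separable states. -/

section Minimax

variable {α β : Type*} [Fintype α] [Fintype β] [DecidableEq α] [DecidableEq β]

/-- The trivial effect `1` contributes `tr(ρ - σ) = 0` to the supremum. -/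
lemma restrictedNorm_sub_nonneg (C : MeasurementClass) {ρ σ : Matrix (α × β) (α × β) ℂ}
    (hρ : IsState ρ) (hσ : IsState σ) : 0 ≤ restrictedNorm C (ρ - σ) := by
  refine Real.sSup_nonneg' ⟨_, ⟨1, C.one_mem, rfl⟩, ?_⟩
  have : (2 : ℂ) • (1 : Matrix (α × β) (α × β) ℂ) - 1 = 1 := by
    rw [two_smul, add_sub_cancel_right]
  simp [this, hρ.2, hσ.2]

/-- Von Neumann's minimax theorem: some measurement tells `ρ` from all separable states at once. -/
lemma exists_effect_of_lt_distToSeparable [Nonempty α] [Nonempty β] (C : MeasurementClass)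
    {ρ : Matrix (α × β) (α × β) ℂ} (hρ : IsState ρ) {δ : ℝ} (hδ : δ < distToSeparable C ρ) :
    ∃ M ∈ C.effects α β, ∀ σ ∈ separableStates α β,
      δ < (((2 : ℂ) • M - 1) * (ρ - σ)).trace.re := by
  obtain ⟨δ', hδδ', hδ'⟩ := exists_between hδ
  have hpt : ∀ σ ∈ separableStates α β, ∃ M ∈ C.effects α β,
      δ' < (((2 : ℂ) • M - 1) * (ρ - σ)).trace.re := by
    intro σ hσ
    have hle : distToSeparable C ρ ≤ restrictedNorm C (ρ - σ) :=
      csInf_le ⟨0, by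
        rintro _ ⟨σ, hσ, rfl⟩
        exact restrictedNorm_sub_nonneg C hρ (isState_of_mem_separableStates hσ)⟩ ⟨σ, hσ, rfl⟩
    obtain ⟨_, ⟨M, hM, rfl⟩, h⟩ := exists_lt_of_lt_csSup
      ((Set.nonempty_of_mem C.one_mem).image _) (hδ'.trans_le hle)
    exact ⟨M, hM, h⟩
  let f : Matrix (α × β) (α × β) ℂ → Matrix (α × β) (α × β) ℂ → ℝ := fun σ M =>
    (((2 : ℂ) • M - 1) * (ρ - σ)).trace.re
  have hfc : ∀ M, Continuous fun σ => f σ M := fun M => by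
    simp only [f]; fun_prop
  have hfc' : ∀ σ, Continuous fun M => f σ M := fun σ => by
    simp only [f]; fun_prop
  have haff : ∀ (M σ τ : Matrix (α × β) (α × β) ℂ) (a b : ℝ), a + b = 1 →
      f (a • σ + b • τ) M = a * f σ M + b * f τ M := by
    intro M σ τ a b hab
    have : ρ - (a • σ + b • τ) = a • (ρ - σ) + b • (ρ - τ) := by
      rw [smul_sub, smul_sub, sub_add_sub_comm, ← add_smul, hab, one_smul]
    simp only [f]
    rw [this, Matrix.mul_add, Matrix.mul_smul, Matrix.mul_smul, trace_add, trace_smul, trace_smul,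
      Complex.add_re, Complex.smul_re, Complex.smul_re, smul_eq_mul, smul_eq_mul]
  have haff' : ∀ (σ M N : Matrix (α × β) (α × β) ℂ) (a b : ℝ), a + b = 1 →
      f σ (a • M + b • N) = a * f σ M + b * f σ N := by
    intro σ M N a b hab
    have : (2 : ℂ) • (a • M + b • N) - 1 = a • ((2 : ℂ) • M - 1) + b • ((2 : ℂ) • N - 1) := by
      rw [smul_sub, smul_sub, sub_add_sub_comm, ← add_smul, hab, one_smul, smul_add,
        smul_comm (2 : ℂ) a, smul_comm (2 : ℂ) b]
    simp only [f]
    rw [this, Matrix.add_mul, Matrix.smul_mul, Matrix.smul_mul, trace_add, trace_smul, trace_smul,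
      Complex.add_re, Complex.smul_re, Complex.smul_re, smul_eq_mul, smul_eq_mul]
  -- Passing to the closure gives compactness from boundedness of the entries alone, without showing
  -- that the separable states form a closed set.
  have hcompact : IsCompact (closure (separableStates α β)) := by
    have hK : IsCompact (Set.univ.pi fun _ => Set.univ.pi fun _ => Metric.closedBall 0 1 :
        Set (α × β → α × β → ℂ)) :=
      isCompact_univ_pi fun _ => isCompact_univ_pi fun _ => isCompact_closedBall _ _
    refine hK.closure_of_subset fun σ hσ i _ j _ => ?_
    have hσ := isState_of_mem_separableStates hσ
    have := norm_apply_le_trace hσ.1 i j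
    rw [hσ.2, Complex.one_re] at this
    simpa using this
  -- A nearby separable `τ` supplies the effect. All effects have entries of norm at most `d`, so
  -- moving from `τ` to `σ` costs less than `δ' - δ`, uniformly in the effect.
  have hpt' : ∀ σ ∈ closure (separableStates α β), ∃ M ∈ C.effects α β, δ < f σ M := by
    intro σ hσ
    let d : ℝ := Fintype.card (α × β)
    let F : Matrix (α × β) (α × β) ℂ → ℝ := fun τ => d * ∑ i, ∑ j, ‖(τ - σ) i j‖
    have hF : Continuous F := by
      simp only [F, Matrix.sub_apply]; fun_prop
    have hopen : IsOpen {τ | F τ < (δ' - δ) / 2} := isOpen_lt hF continuous_const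
    obtain ⟨τ, hτF, hτ⟩ := mem_closure_iff.1 hσ _ hopen (by simp [F]; linarith)
    obtain ⟨M, hM, h⟩ := hpt τ hτ
    refine ⟨M, hM, ?_⟩
    have hMs := C.separable_of_mem hM
    have hMd : ∀ i j, ‖M i j‖ ≤ d := fun i j => by
      refine (norm_apply_le_trace (posSemidef_of_mem_separableOperators hMs.1) i j).trans ?_
      have := (Complex.le_def.1 (posSemidef_of_mem_separableOperators hMs.2).trace_nonneg).1
      rw [trace_sub, trace_one, Complex.sub_re] at this
      simpa [d] using this
    have hb := (Complex.abs_re_le_norm _).trans (norm_trace_mul_le (X := τ - σ) hMd)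
    have hF' : d * ∑ i, ∑ j, ‖(τ - σ) i j‖ < (δ' - δ) / 2 := hτF
    have hdiff : f σ M = f τ M + 2 * (M * (τ - σ)).trace.re - (τ - σ).trace.re := by
      simp only [f, Matrix.sub_mul, Matrix.mul_sub, Matrix.smul_mul, Matrix.one_mul, trace_sub,
        trace_smul, Complex.sub_re, smul_eq_mul, Complex.mul_re]
      simp
      ring
    have htr : (τ - σ).trace.re = 0 := by
      have hcl : closure (separableStates α β) ⊆ {X | X.trace.re = 1} := by
        refine closure_minimal (fun X hX => ?_) (isClosed_eq (by fun_prop) continuous_const)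
        simp [(isState_of_mem_separableStates hX).2]
      have h1 : σ.trace.re = 1 := hcl hσ
      have h2 : τ.trace.re = 1 := hcl (subset_closure hτ)
      rw [trace_sub, Complex.sub_re, h1, h2, sub_self]
    have := (abs_le.1 hb).1
    change δ' < f τ M at h
    rw [hdiff, htr]
    linarith
  -- Compactness on the state side leaves finitely many effects that already beat `δ` everywhere;
  -- this form of Sion's theorem then needs no compactness of the set of effects.
  obtain ⟨s, hsC, hs⟩ := hcompact.elim_finite_subcover_image (b := C.effects α β)
    (c := fun M => {σ | δ < f σ M}) (fun M _ => isOpen_lt continuous_const (hfc M))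
    (fun σ hσ => by
      obtain ⟨M, hM, h⟩ := hpt' σ hσ
      exact Set.mem_biUnion hM h)
  obtain ⟨M, hM, h⟩ := Sion.exists_lt_iInf_of_lt_iInf_of_finite (f := f)
    (X := closure (separableStates α β)) (Y := C.effects α β)
    (separableStates_nonempty.closure) hcompact
    (fun M _ => (hfc M).lowerSemicontinuous.lowerSemicontinuousOn _)
    (fun M _ => by
      refine ConvexOn.quasiconvexOn ⟨convex_separableStates.closure, ?_⟩
      intro σ _ τ _ a b _ _ hab
      exact (haff M σ τ a b hab).le)
    C.convex_effects
    (fun σ _ => (hfc' σ).upperSemicontinuous.upperSemicontinuousOn _)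
    (fun σ _ => by
      refine ConcaveOn.quasiconcaveOn ⟨C.convex_effects, ?_⟩
      intro M _ N _ a b _ _ hab
      exact (haff' σ M N a b hab).ge)
    convex_separableStates.closure
    hs.1 hsC (t := δ) (fun σ hσ => by
      obtain ⟨M, hM, h⟩ := Set.mem_iUnion₂.1 (hs.2 hσ)
      exact ⟨M, hM, h⟩)
  exact ⟨M, hM, fun σ hσ => h σ (subset_closure hσ)⟩

end Minimax

/-! ### Achievable rates and their supremum. -/

section Rates

variable {α β : Type*} [Fintype α] [Fintype β]

lemma SeparableErrorRateAtLeast.mono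
    {M : (n : ℕ) → Matrix ((Fin n → α) × (Fin n → β)) ((Fin n → α) × (Fin n → β)) ℂ} {r r' : ℝ}
    (h : SeparableErrorRateAtLeast M r) (hr : r' ≤ r) : SeparableErrorRateAtLeast M r' :=
  fun n hn ω hω => (h n hn ω hω).trans <| Real.rpow_le_rpow_of_exponent_le one_le_two <|
    neg_le_neg <| mul_le_mul_of_nonneg_left hr n.cast_nonneg

variable [DecidableEq α] [DecidableEq β]

/-- `ρ^{⊗ n}` can be told apart from separable states at the rate `r`. -/
def IsAchievable (C : MeasurementClass) (ρ : Matrix (α × β) (α × β) ℂ) (r : ℝ) : Prop :=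
  ∃ M, IsTest C M ∧ AcceptsAsymptotically M ρ ∧ SeparableErrorRateAtLeast M r

lemma isAchievable_zero (C : MeasurementClass) {ρ : Matrix (α × β) (α × β) ℂ} (hρ : IsState ρ) :
    IsAchievable C ρ 0 := by
  refine ⟨fun _ => 1, fun n => C.one_mem, ?_, fun n _ ω hω => ?_⟩
  · simp [AcceptsAsymptotically, (isState_tensorPower hρ _).2]
  · simp [(isState_of_mem_separableStates hω).2]

/-- The identity is separable with trace `dⁿ`, so the error bound gives `tr Mₙ ≤ dⁿ 2^(-nr)`. A
crude entrywise estimate on `ρ^{⊗ n}` costs a further `d^(2n)`; once `d³ 2^(-r) < 1`, acceptance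
tends to zero. -/
lemma IsAchievable.le [Nonempty α] [Nonempty β] {C : MeasurementClass}
    {ρ : Matrix (α × β) (α × β) ℂ} (hρ : IsState ρ) {r : ℝ} (h : IsAchievable C ρ r) :
    r ≤ Real.logb 2 ((Fintype.card (α × β) : ℝ) ^ 3) := by
  obtain ⟨M, hM, hacc, herr⟩ := h
  set d : ℝ := (Fintype.card (α × β) : ℝ) with hd
  have hd0 : 0 < d := by
    rw [hd]
    exact_mod_cast Fintype.card_pos
  by_contra! hr
  have hlt : d ^ 3 * (2 : ℝ) ^ (-r) < 1 := by
    rw [Real.logb_lt_iff_lt_rpow one_lt_two (by positivity)] at hr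
    rw [Real.rpow_neg zero_le_two, ← div_eq_mul_inv, div_lt_one (by positivity)]
    exact hr
  have hbound : ∀ n : ℕ, 1 ≤ n →
      (M n * tensorPower ρ n).trace.re ≤ (d ^ 3 * (2 : ℝ) ^ (-r)) ^ n := by
    intro n hn
    have hcard : (Fintype.card ((Fin n → α) × (Fin n → β)) : ℝ) = d ^ n := by
      simp [hd, mul_pow]
    have hMpos := posSemidef_of_mem_separableOperators (C.separable_of_mem (hM n)).1
    have htr : (M n).trace.re ≤ (2 : ℝ) ^ (-((n : ℝ) * r)) * d ^ n := by
      have := trace_mul_le_of_forall_separableStates (herr n hn) one_mem_separableOperators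
      rw [Matrix.mul_one, trace_one, Complex.natCast_re, hcard] at this
      exact this
    have hstate := isState_tensorPower hρ n
    have hsum : ∑ i, ∑ j, ‖tensorPower ρ n i j‖ ≤ d ^ n * d ^ n := by
      calc _ ≤ ∑ _i : (Fin n → α) × (Fin n → β), ∑ _j : (Fin n → α) × (Fin n → β), (1 : ℝ) := by
            refine Finset.sum_le_sum fun i _ => Finset.sum_le_sum fun j _ => ?_
            have := norm_apply_le_trace hstate.1 i j
            rwa [hstate.2, Complex.one_re] at this
        _ = d ^ n * d ^ n := by
            simp only [Finset.sum_const, Finset.card_univ, nsmul_eq_mul, mul_one, hcard]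
    have hpow : (2 : ℝ) ^ (-((n : ℝ) * r)) = ((2 : ℝ) ^ (-r)) ^ n := by
      rw [← Real.rpow_natCast, ← Real.rpow_mul zero_le_two]
      ring_nf
    calc _ ≤ (M n).trace.re * ∑ i, ∑ j, ‖tensorPower ρ n i j‖ :=
          (Complex.re_le_norm _).trans (norm_trace_mul_le (norm_apply_le_trace hMpos))
      _ ≤ ((2 : ℝ) ^ (-((n : ℝ) * r)) * d ^ n) * (d ^ n * d ^ n) :=
          mul_le_mul htr hsum (by positivity) (by positivity)
      _ = _ := by rw [hpow]; ring
  have hlim := tendsto_pow_atTop_nhds_zero_of_lt_one (by positivity) hlt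
  have := le_of_tendsto_of_tendsto hacc hlim
    ((Filter.eventually_ge_atTop 1).mono fun n hn => hbound n hn)
  linarith

/-- With `p = tr(Mρ)` and `tr(Mσ) ≤ p - y` on separable states, any threshold frequency strictly
between the two makes both errors decay. The value `p - y + x` lies `x` above the separable mean,
for the exponent `x²/2`, and `y - x > 0` below `p`, which is enough for acceptance. -/
lemma isAchievable_of_lt_distToSeparable [Nonempty α] [Nonempty β] (C : MeasurementClass)
    {ρ : Matrix (α × β) (α × β) ℂ} (hρ : IsState ρ) {x : ℝ} (hx : 0 ≤ x)
    (hxd : x < distToSeparable C ρ / 2) : IsAchievable C ρ (x ^ 2 / (2 * Real.log 2)) := by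
  obtain ⟨y, hxy, hyd⟩ := exists_between hxd
  obtain ⟨M, hM, hMσ⟩ := exists_effect_of_lt_distToSeparable C hρ
    (show 2 * y < distToSeparable C ρ by linarith)
  obtain ⟨hMs, hMs'⟩ := C.separable_of_mem hM
  have hMp := posSemidef_of_mem_separableOperators hMs
  have hMp' := posSemidef_of_mem_separableOperators hMs'
  set p := (M * ρ).trace.re with hp
  have hp0 : 0 ≤ p := trace_re_nonneg hMp hρ.1
  have hp1 : p ≤ 1 := by
    have := trace_re_nonneg hMp' hρ.1
    rw [trace_one_sub_mul, hρ.2, Complex.one_re] at this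
    linarith
  have hq : ∀ σ ∈ separableStates α β, (M * σ).trace.re ≤ p - y := by
    intro σ hσ
    have h := hMσ σ hσ
    simp only [Matrix.sub_mul, Matrix.mul_sub, Matrix.smul_mul, Matrix.one_mul, trace_sub,
      trace_smul, Complex.sub_re, smul_eq_mul, Complex.mul_re, hρ.2,
      (isState_of_mem_separableStates hσ).2] at h
    simp at h
    linarith
  have hq0 : 0 ≤ p - y := by
    obtain ⟨σ, hσ⟩ := separableStates_nonempty (α := α) (β := β)
    exact (trace_re_nonneg hMp (isState_of_mem_separableStates hσ).1).trans (hq σ hσ)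
  have hlog : 0 < Real.log 2 := Real.log_pos one_lt_two
  refine ⟨fun n => thresholdTest M n (n * (p - y + x)), fun n => C.thresholdTest_mem hM _ _, ?_, ?_⟩
  · have hη : 0 < y - x := sub_pos.2 hxy
    have hupper : ∀ n : ℕ, ((1 - thresholdTest M n (n * (p - y + x))) * tensorPower ρ n).trace.re
        ≤ Real.exp (-((y - x) ^ 2 / 2)) ^ n := by
      intro n
      -- The Chernoff parameter `s = y - x` minimises the exponent `s²/2 - s(y - x)`.
      refine (trace_one_sub_thresholdTest_mul_le hMp hMp' hρ hη.le n _).trans ?_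
      have h := bernoulli_mgf_le hp0 hp1 (-(y - x))
      have h0 : 0 ≤ p * Real.exp (-(y - x)) + (1 - p) := by
        have := sub_nonneg.2 hp1
        positivity
      calc _ ≤ Real.exp ((y - x) * (n * (p - y + x))) *
            Real.exp (p * -(y - x) + (-(y - x)) ^ 2 / 2) ^ n :=
            mul_le_mul_of_nonneg_left (pow_le_pow_left₀ h0 h n) (Real.exp_pos _).le
        _ = _ := by
            rw [← Real.exp_nat_mul, ← Real.exp_nat_mul, ← Real.exp_add]
            ring_nf
    have hlower : ∀ n : ℕ,
        0 ≤ ((1 - thresholdTest M n (n * (p - y + x))) * tensorPower ρ n).trace.re := fun n =>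
      trace_re_nonneg
        (posSemidef_of_mem_separableOperators (thresholdTest_separable hMs hMs' n _).2)
        (isState_tensorPower hρ n).1
    have hlim := squeeze_zero hlower hupper (tendsto_pow_atTop_nhds_zero_of_lt_one
      (Real.exp_pos _).le (Real.exp_lt_one_iff.2 (neg_lt_zero.2 (by positivity))))
    have := (tendsto_const_nhds (x := (1 : ℝ))).sub hlim
    simp only [trace_one_sub_mul, (isState_tensorPower hρ _).2, Complex.one_re, sub_sub_cancel,
      sub_zero] at this
    exact this
  · intro n _ ω hω
    have hc : 0 ≤ (p - y) * Real.exp x + (1 - (p - y)) := by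
      have : 0 ≤ 1 - (p - y) := by linarith
      positivity
    -- Here `s = x`, and `c` is the moment generating function of a Bernoulli variable of the
    -- largest allowed mean `p - y`; it dominates because `exp x ≥ 1`.
    have h := trace_thresholdTest_mul_le hMs hMs' hx hc (fun X hX => by
      have h := trace_mul_le_of_forall_separableStates hq hX
      have he : 0 ≤ Real.exp x - 1 := sub_nonneg.2 (Real.one_le_exp hx)
      rw [trace_one_sub_mul]
      nlinarith [mul_le_mul_of_nonneg_left h he]) n (n * (p - y + x)) (separableStates_subset hω).1
    rw [(separableStates_subset hω).2, Complex.one_re, mul_one] at h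
    refine h.trans ?_
    calc _ ≤ Real.exp (-(x * (n * (p - y + x)))) * Real.exp ((p - y) * x + x ^ 2 / 2) ^ n :=
          mul_le_mul_of_nonneg_left
            (pow_le_pow_left₀ hc (bernoulli_mgf_le hq0 (by linarith) x) n) (Real.exp_pos _).le
      _ = _ := by
          rw [Real.rpow_def_of_pos two_pos, ← Real.exp_nat_mul, ← Real.exp_add]
          congr 1
          field_simp
          ring

lemma IsOptimalRate.unique {C : MeasurementClass} {ρ : Matrix (α × β) (α × β) ℂ} {D D' : ℝ}
    (h : IsOptimalRate C ρ D) (h' : IsOptimalRate C ρ D') : D = D' := by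
  have key : ∀ {D D' : ℝ}, IsOptimalRate C ρ D → IsOptimalRate C ρ D' → D ≤ D' := by
    intro D D' h h'
    by_contra! hlt
    -- Half the gap: the test reaches the midpoint of `D'` and `D`, which the converse for `D'`
    -- forbids.
    obtain ⟨M, hM, hacc, herr⟩ := h.direct ((D - D') / 2) (by linarith)
    exact h'.converse ((D - D') / 2) (by linarith) M hM (herr.mono (by linarith)) hacc
  exact le_antisymm (key h h') (key h' h)

lemma isOptimalRate_sSup [Nonempty α] [Nonempty β] (C : MeasurementClass)
    {ρ : Matrix (α × β) (α × β) ℂ} (hρ : IsState ρ) :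
    IsOptimalRate C ρ (sSup {r | IsAchievable C ρ r}) := by
  have hbdd : BddAbove {r | IsAchievable C ρ r} := ⟨_, fun r hr => IsAchievable.le hρ hr⟩
  have hzero : IsAchievable C ρ 0 := isAchievable_zero C hρ
  refine ⟨le_csSup hbdd hzero, fun ε hε => ?_, fun ε hε M hM herr hacc => ?_⟩
  · obtain ⟨r, ⟨M, hM, hacc, herr⟩, hr⟩ := exists_lt_of_lt_csSup ⟨0, hzero⟩
      (sub_lt_self (sSup {r | IsAchievable C ρ r}) hε)
    exact ⟨M, hM, hacc, herr.mono hr.le⟩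
  · have := le_csSup hbdd (show IsAchievable C ρ _ from ⟨M, hM, hacc, herr⟩)
    linarith

lemma IsOptimalRate.le_of_isAchievable {C : MeasurementClass} {ρ : Matrix (α × β) (α × β) ℂ}
    {D r : ℝ} (h : IsOptimalRate C ρ D) (hr : IsAchievable C ρ r) : r ≤ D := by
  by_contra! hlt
  obtain ⟨M, hM, hacc, herr⟩ := hr
  exact h.converse (r - D) (by linarith) M hM (by simpa using herr) hacc

lemma IsState.nonempty {ι : Type*} [Fintype ι] {ρ : Matrix ι ι ℂ} (hρ : IsState ρ) :
    Nonempty ι := by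
  by_contra h
  rw [not_nonempty_iff] at h
  have := hρ.2
  simp [Matrix.trace] at this

lemma IsOptimalRate.sq_distToSeparable_le [Nonempty α] [Nonempty β] {C : MeasurementClass}
    {ρ : Matrix (α × β) (α × β) ℂ} (hρ : IsState ρ) {D : ℝ} (h : IsOptimalRate C ρ D) :
    1 / (8 * Real.log 2) * distToSeparable C ρ ^ 2 ≤ D := by
  have hlog : 0 < Real.log 2 := Real.log_pos one_lt_two
  have hdist : 0 ≤ distToSeparable C ρ := by
    refine Real.sInf_nonneg ?_
    rintro _ ⟨σ, hσ, rfl⟩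
    exact restrictedNorm_sub_nonneg C hρ (isState_of_mem_separableStates hσ)
  -- At distance zero the open interval used below is empty, but the claim is just `0 ≤ D`.
  rcases hdist.eq_or_lt with h0 | hpos
  · simpa [← h0] using h.nonneg
  have hle : ∀ x ∈ Set.Ioo 0 (distToSeparable C ρ / 2), x ^ 2 / (2 * Real.log 2) ≤ D := fun x hx =>
    h.le_of_isAchievable (isAchievable_of_lt_distToSeparable C hρ hx.1.le hx.2)
  -- The inequality is closed in `x`, so it extends to the endpoint, half the distance, which yields
  -- `(1/4) · 1/(2 ln 2)`.
  have hcl : ∀ x ∈ closure (Set.Ioo 0 (distToSeparable C ρ / 2)), x ^ 2 / (2 * Real.log 2) ≤ D :=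
    fun x hx => closure_minimal (t := {x | x ^ 2 / (2 * Real.log 2) ≤ D}) hle
      (isClosed_le (by fun_prop) continuous_const) hx
  rw [closure_Ioo (by positivity)] at hcl
  have := hcl (distToSeparable C ρ / 2) ⟨by positivity, le_rfl⟩
  convert this using 1
  field_simp
  ring

end Rates

end BipartiteTesting

theorem mainTheorem8 {α β : Type*} [Fintype α] [Fintype β] [DecidableEq α] [DecidableEq β]
    (C : BipartiteTesting.MeasurementClass) (ρ : Matrix (α × β) (α × β) ℂ)
    (hρ : BipartiteTesting.IsState ρ) :
    (∃! D : ℝ, BipartiteTesting.IsOptimalRate C ρ D) ∧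
      ∀ D : ℝ, BipartiteTesting.IsOptimalRate C ρ D →
        1 / (8 * Real.log 2) * BipartiteTesting.distToSeparable C ρ ^ 2 ≤ D := by
  obtain ⟨a, b⟩ := hρ.nonempty
  have : Nonempty α := ⟨a⟩
  have : Nonempty β := ⟨b⟩
  have hD := BipartiteTesting.isOptimalRate_sSup C hρ
  exact ⟨⟨_, hD, fun _ h => h.unique hD⟩, fun _ h => h.sq_distToSeparable_le hρ⟩
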